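/- **Ergodicity Criterion.** Let $(M,\omega)$ be a compact connected translation surface, i.e. a compact connected Riemann surface $M$ with a nonzero holomorphic 1-form $\omega$, with singular set $\Sigma=\{\omega=0\}$ and area form $\frac i2\,\omega\wedge\overline\omega$. For $\theta\in\mathbb R$ the directional flow $\phi^\theta_t$ is the flow of the vector field $X_\theta$ on $M\setminus\Sigma$ with $\omega(X_\theta)=e^{i\theta}$; trajectories are followed as long as they do not reach $\Sigma$. The same definitions apply to a cover $\widetilde M$ of $M$ with the pulled back form. A directional flow is called ergodic if every invariant measurable set has zero area or has a complement of zero area. Let $\gamma_1,\gamma_2\in H_1(M;\mathbb Z)$ be linearly independent classes with $\int_{\gamma_1}\omega=\int_{\gamma_2}\omega=0$, let $\langle\cdot,\cdot\rangle$ be the algebraic intersection form on $H_1(M;\mathbb Z)$, and let $p\colon(\widetilde M_\Gamma,\widetilde\omega)\to(M,\omega)$, $\widetilde\omega=p^*\omega$, be the $\mathbb Z^2$-cover given by $\Gamma=(\gamma_1,\gamma_2)$: its deck group $\mathbb Z^2$ acts simply transitively on the fibres, and a lift $\widetilde\sigma\colon[0,1]\to\widetilde M_\Gamma$ of a closed curve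 $\sigma$ in $M$ satisfies $\widetilde\sigma(1)=\bigl(\langle\gamma_1,[\sigma]\rangle,\langle\gamma_2,[\sigma]\rangle\bigr)\cdot\widetilde\sigma(0)$. A cylinder $C\subset M$ is a maximal connected union of pairwise homotopic simple closed geodesics of the flat metric in $M\setminus\Sigma$. Write $A(C)$ for its area, $\delta(C)\in H_1(M;\mathbb Z)$ for the class of a core curve (one of these geodesics, with either orientation), $v(C)=\int_{\delta(C)}\omega\in\mathbb C\cong\mathbb R^2$ for its displacement vector, and $k(C)=\bigl(\langle\gamma_1,\delta(C)\rangle,\langle\gamma_2,\delta(C)\rangle\bigr)\in\mathbb Z^2$. If $k(C)\ne(0,0)$, the lifts of $C$ to $\widetilde M_\Gamma$ (the connected components of $p^{-1}(C)$) are called strips. For $k\in\mathbb Z^2\setminus\{(0,0)\}$ we say that $\theta$ is well approximated by strips producing the value $k$ if there is $\epsilon>0$ such that there are strips, lying over infinitely many different cylinders $C$ of $M$, for which (with a suitable orientation of the core curve) $$k(C)=k,\qquad A(C)>\epsilon,\qquad \bigl|(\cos\theta,\sin\theta)\wedge v(C)\bigr|\le(1-\epsilon)\frac{A(C)}{2\|v(C)\|}.$$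 Suppose that the directional flow $\phi^\theta_t$ on $(M,\omega)$ is ergodic, and that $\theta$ is well approximated by strips producing a value $k^h\in\{(1,0),(-1,0)\}$ and also by strips producing a value $k^v\in\{(0,1),(0,-1)\}$. Then the directional flow $\widetilde\phi^\theta_t$ on $(\widetilde M_\Gamma,\widetilde\omega)$ is ergodic. -/

import Mathlib

open scoped Manifold ContDiff

noncomputable section

namespace TranslationSurface

open CategoryTheory MeasureTheory Set

universe u v

/-! ### Abelian differentials -/

section Differentials

variable (M : Type u) [TopologicalSpace M] [ChartedSpace ℂ M]

/-- A nonzero holomorphic 1-form on a Riemann surface `M`: a complex-linear form on every tangent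
space whose coefficient `f` in each chart (where the form reads `f(z) dz`) is holomorphic. -/
structure AbelianDifferential where
  form : (x : M) → TangentSpace 𝓘(ℂ, ℂ) x →L[ℂ] ℂ
  holomorphic : ∀ e ∈ atlas ℂ M, DifferentiableOn ℂ
    (fun z : ℂ => form (e.symm z) (mfderiv 𝓘(ℂ, ℂ) 𝓘(ℂ, ℂ) e.symm z (1 : ℂ))) e.target
  nonzero : ∃ x, form x ≠ 0

variable {M} (η : AbelianDifferential M)

namespace AbelianDifferential

/-- The set of zeros of the differential, i.e. the singularities of the translation surface. -/
def zeros : Set M := {x | η.form x = 0}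

/-- The vector field `X` with `η(X) = w` off the zeros of `η`. The tangent space at `x` is a copy of
`ℂ`, on which the complex-linear form `η.form x` is multiplication by `η.form x 1`. -/
def field (w : ℂ) (x : M) : TangentSpace 𝓘(ℝ, ℂ) x :=
  (w / η.form x (1 : ℂ) : ℂ)

theorem form_field (w : ℂ) {x : M} (hx : x ∉ η.zeros) :
    η.form x (η.field w x : ℂ) = w := by
  have key : ∀ L : ℂ →L[ℂ] ℂ, L ≠ 0 → L (w / L 1) = w := fun L hL => by
    have h1 : ∀ c : ℂ, L c = c * L 1 := fun c => by
      simpa only [smul_eq_mul, mul_one] using L.map_smul c (1 : ℂ)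
    have h0 : L 1 ≠ 0 := fun h => hL (by ext; simpa using h)
    rw [h1, div_mul_cancel₀ w h0]
  exact key (η.form x) hx

/-- `e` is a natural coordinate of the translation surface: `de = η` on the domain of `e`. -/
def IsNaturalChart (e : OpenPartialHomeomorph M ℂ) : Prop :=
  ∀ x ∈ e.source, HasMFDerivAt 𝓘(ℂ, ℂ) 𝓘(ℂ, ℂ) e x (η.form x)

/-- The area measure of the area form `(i/2) η ∧ η̄`: the smallest measure that dominates, for every
natural coordinate `e`, the Lebesgue measure transported to the domain of `e`. As these agree on
overlaps, it restricts to Lebesgue measure in each natural coordinate, and the zeros are null. -/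
def area [MeasurableSpace M] : Measure M :=
  ⨆ e : {e : OpenPartialHomeomorph M ℂ // η.IsNaturalChart e},
    Measure.map e.1.symm (volume.restrict e.1.target)

/-! ### The directional flow -/

/-- `φ_t^θ(x) = y`: the unit speed straight-line trajectory in direction `θ` starting at `x` avoids
the singularities up to time `t`, and it is at `y` at time `t`. -/
def FlowsTo (θ t : ℝ) (x y : M) : Prop :=
  ∃ c : ℝ → M, c 0 = x ∧ c t = y ∧ (∀ s ∈ uIcc 0 t, c s ∉ η.zeros) ∧
    IsMIntegralCurveOn c (η.field (Complex.exp (θ * Complex.I))) (uIcc 0 t)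

/-- The directional flow in direction `θ` is ergodic for the area measure: every invariant
measurable set is null or has null complement. -/
def IsErgodicDirection [MeasurableSpace M] (θ : ℝ) : Prop :=
  ∀ A : Set M, MeasurableSet A → (∀ t x y, η.FlowsTo θ t x y → (x ∈ A ↔ y ∈ A)) →
    η.area A = 0 ∨ η.area Aᶜ = 0

end AbelianDifferential

end Differentials

/-! ### Closed curves and their homology classes -/

/-- A closed curve in `M`, as a continuous map on `ℝ` of period `1`. -/
structure ClosedCurve (M : Type u) [TopologicalSpace M] where
  toFun : ℝ → M
  continuous : Continuous toFun
  periodic : Function.Periodic toFun 1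

/-- The first singular homology group `H₁(M; ℤ)`. -/
abbrev H1 (M : Type u) [TopologicalSpace M] : ModuleCat.{u} ℤ :=
  ((AlgebraicTopology.singularHomologyFunctor (ModuleCat.{u} ℤ) 1).obj
    (ModuleCat.of ℤ (ULift.{u} ℤ))).obj (TopCat.of M)

namespace ClosedCurve

variable {M : Type u} [TopologicalSpace M]

/-- The singular 1-simplex given by `σ` on `[0, 1]`. -/
def simplex (σ : ClosedCurve M) : (TopCat.toSSet.obj (TopCat.of M)).obj (.op (.mk 1)) :=
  ((TopCat.of M).toSSetObjEquiv (.op (.mk 1))).symm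
    ⟨fun s => σ.toFun (stdSimplexHomeomorphUnitInterval s : ℝ),
      σ.continuous.comp (continuous_subtype_val.comp stdSimplexHomeomorphUnitInterval.continuous)⟩

theorem simplex_d (σ : ClosedCurve M) :
    (TopCat.toSSet.obj (TopCat.of M)).ιChainComplex (R := ModuleCat.of ℤ (ULift.{u} ℤ)) σ.simplex ≫
      ((TopCat.toSSet.obj (TopCat.of M)).chainComplex (ModuleCat.of ℤ (ULift.{u} ℤ))).d 1 0 = 0 := by
  have hδ : (TopCat.toSSet.obj (TopCat.of M)).δ 0 σ.simplex =
      (TopCat.toSSet.obj (TopCat.of M)).δ 1 σ.simplex := by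
    apply ((TopCat.of M).toSSetObjEquiv (.op (.mk 0))).injective
    ext s
    obtain rfl : s = default := Subsingleton.elim _ _
    change σ.toFun (stdSimplexHomeomorphUnitInterval
        (stdSimplex.map (SimplexCategory.δ (0 : Fin 2)) default) : ℝ) =
      σ.toFun (stdSimplexHomeomorphUnitInterval
        (stdSimplex.map (SimplexCategory.δ (1 : Fin 2)) default) : ℝ)
    have h0 : stdSimplexHomeomorphUnitInterval
        (stdSimplex.map (SimplexCategory.δ (0 : Fin 2)) default) = 1 := by
      rw [show (default : stdSimplex ℝ (Fin 1)) = stdSimplex.vertex 0 from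
        Subsingleton.elim _ _, stdSimplex.map_vertex]
      exact stdSimplexHomeomorphUnitInterval_one
    have h1 : stdSimplexHomeomorphUnitInterval
        (stdSimplex.map (SimplexCategory.δ (1 : Fin 2)) default) = 0 := by
      rw [show (default : stdSimplex ℝ (Fin 1)) = stdSimplex.vertex 0 from
        Subsingleton.elim _ _, stdSimplex.map_vertex]
      exact stdSimplexHomeomorphUnitInterval_zero
    rw [h0, h1]
    simpa using σ.periodic 0
  rw [SSet.ιChainComplex_d]
  simp [Fin.sum_univ_two, hδ]

/-- The class `[σ] ∈ H₁(M; ℤ)`: the homology class of the singular cycle `1 · σ`. -/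
def homologyClass (σ : ClosedCurve M) : H1 M :=
  (((TopCat.toSSet.obj (TopCat.of M)).chainComplex (ModuleCat.of ℤ (ULift.{u} ℤ))).liftCycles
      ((TopCat.toSSet.obj (TopCat.of M)).ιChainComplex σ.simplex) 0 (by simp) σ.simplex_d ≫
    ((TopCat.toSSet.obj (TopCat.of M)).chainComplex (ModuleCat.of ℤ (ULift.{u} ℤ))).homologyπ 1)
      (ULift.up 1 : ULift.{u} ℤ)

/-- Free homotopy of closed curves. -/
def Homotopic (σ τ : ClosedCurve M) : Prop :=
  ∃ H : unitInterval × ℝ → M, Continuous H ∧ (∀ t, H (0, t) = σ.toFun t) ∧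
    (∀ t, H (1, t) = τ.toFun t) ∧ ∀ s t, H (s, t + 1) = H (s, t)

variable [ChartedSpace ℂ M]

def IsSmooth (σ : ClosedCurve M) : Prop :=
  ContMDiff 𝓘(ℝ, ℝ) 𝓘(ℝ, ℂ) ∞ σ.toFun

/-- The velocity of `σ`, as an element of the tangent space at `σ t`, which is a copy of `ℂ`. -/
def velocity (σ : ClosedCurve M) (t : ℝ) : ℂ :=
  (mfderiv 𝓘(ℝ, ℝ) 𝓘(ℝ, ℂ) σ.toFun t (1 : ℝ) : TangentSpace 𝓘(ℝ, ℂ) (σ.toFun t))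

/-- The determinant of the velocities of `σ` at `s` and of `τ` at `t`. It is used only when
`σ s = τ t`; then its sign is intrinsic, as the charts preserve the orientation. -/
def crossing (σ τ : ClosedCurve M) (s t : ℝ) : ℝ :=
  (σ.velocity s).re * (τ.velocity t).im - (σ.velocity s).im * (τ.velocity t).re

def Transverse (σ τ : ClosedCurve M) : Prop :=
  ∀ s t, σ.toFun s = τ.toFun t → σ.crossing τ s t ≠ 0

/-- The sum of the signs of all crossings of `σ` and `τ`. -/
def crossingNumber (σ τ : ClosedCurve M) : ℤ :=
  ∑ᶠ q ∈ {q : ℝ × ℝ | q.1 ∈ Ico 0 1 ∧ q.2 ∈ Ico 0 1 ∧ σ.toFun q.1 = τ.toFun q.2},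
    (SignType.sign (σ.crossing τ q.1 q.2) : ℤ)

end ClosedCurve

/-- The algebraic intersection form `⟨x, y⟩` on `H₁(M; ℤ)`, for a compact connected Riemann surface
`M`: the signed number of crossings of transverse smooth closed curves in the classes `x` and `y`.
Such curves always exist, and the number does not depend on them. -/
def intersection {M : Type u} [TopologicalSpace M] [ChartedSpace ℂ M] (x y : H1 M) : ℤ :=
  Classical.epsilon fun n : ℤ => ∃ σ τ : ClosedCurve M, σ.IsSmooth ∧ τ.IsSmooth ∧
    σ.homologyClass = x ∧ τ.homologyClass = y ∧ σ.Transverse τ ∧ σ.crossingNumber τ = n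

/-- The holonomy `∫_x η ∈ ℂ` of a class `x ∈ H₁(M; ℤ)`, for a connected Riemann surface `M`: the
integral over any smooth closed curve in the class. -/
def AbelianDifferential.hol {M : Type u} [TopologicalSpace M] [ChartedSpace ℂ M]
    (η : AbelianDifferential M) (x : H1 M) : ℂ :=
  Classical.epsilon fun w : ℂ => ∃ σ : ClosedCurve M, σ.IsSmooth ∧ σ.homologyClass = x ∧
    ∫ t in (0 : ℝ)..1, η.form (σ.toFun t) (σ.velocity t) = w

/-! ### Cylinders -/

section Cylinders

variable {M : Type u} [TopologicalSpace M] [ChartedSpace ℂ M]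

/-- A simple closed geodesic of the flat metric, off the singularities, with displacement vector
`w` (hence of length `‖w‖`), with the parameter proportional to arc length. -/
structure ClosedGeodesic (η : AbelianDifferential M) (w : ℂ) extends ClosedCurve M where
  displacement_ne_zero : w ≠ 0
  regular : ∀ t, toFun t ∉ η.zeros
  geodesic : IsMIntegralCurve toFun (η.field w)
  simple : InjOn toFun (Ico 0 1)

/-- `C` is a cylinder whose core curves, suitably oriented, have displacement vector `w`: a maximal
connected union of pairwise homotopic simple closed geodesics. (Homotopic closed geodesics have the
same displacement vector.) -/
def IsCylinder (η : AbelianDifferential M) (w : ℂ) (C : Set M) : Prop :=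
  Maximal (fun S : Set M => IsConnected S ∧ ∃ G : Set (ClosedGeodesic η w),
    S = ⋃ g ∈ G, range g.toFun ∧
      ∀ g ∈ G, ∀ g' ∈ G, g.toClosedCurve.Homotopic g'.toClosedCurve) C

end Cylinders

/-! ### The `ℤ²`-cover and strips -/

section Cover

variable {M : Type u} [TopologicalSpace M] [ChartedSpace ℂ M]
  {N : Type v} [TopologicalSpace N] [ChartedSpace ℂ N]

/-- `p : (N, ηN) → (M, η)` is the `ℤ²`-cover given by `(γ₁, γ₂)`: a translation cover with deck group
`ℤ²` acting simply transitively on the fibres, such that each lift of a closed curve `σ` from `0` to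
`1` ends at the translate of its initial point by `(⟨γ₁, [σ]⟩, ⟨γ₂, [σ]⟩)`. -/
structure IsZ2Cover (η : AbelianDifferential M) (γ₁ γ₂ : H1 M) (ηN : AbelianDifferential N)
    [AddAction (ℤ × ℤ) N] (p : N → M) : Prop where
  isCoveringMap : IsCoveringMap p
  surjective : Function.Surjective p
  holomorphic : MDifferentiable 𝓘(ℂ, ℂ) 𝓘(ℂ, ℂ) p
  pullback : ∀ x, ηN.form x = (η.form (p x)).comp (mfderiv 𝓘(ℂ, ℂ) 𝓘(ℂ, ℂ) p x)
  continuous_deck : ∀ n : ℤ × ℤ, Continuous fun x : N => n +ᵥ x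
  deck : ∀ (n : ℤ × ℤ) (x : N), p (n +ᵥ x) = p x
  fibre : ∀ x y : N, p x = p y → ∃! n : ℤ × ℤ, n +ᵥ x = y
  monodromy : ∀ (σ : ClosedCurve M) (τ : ℝ → N), Continuous τ → (∀ t, p (τ t) = σ.toFun t) →
    τ 1 = (intersection γ₁ σ.homologyClass, intersection γ₂ σ.homologyClass) +ᵥ τ 0

/-- The direction `θ` is well approximated by strips of `N` producing the value `k ≠ (0, 0)`. A strip
is a lift to `N` (a connected component `S` of the preimage) of a cylinder `C` of `M` that has a core
curve `g` with `k(C) = (⟨γ₁, [g]⟩, ⟨γ₂, [g]⟩) ≠ (0, 0)`. The strips have to lie over infinitely many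
different cylinders. -/
def WellApproximatedByStrips [MeasurableSpace M] (η : AbelianDifferential M) (γ₁ γ₂ : H1 M)
    (p : N → M) (θ : ℝ) (k : ℤ × ℤ) : Prop :=
  k ≠ 0 ∧ ∃ ε : ℝ, 0 < ε ∧ {C : Set M | ∃ S : Set N,
    (∃ x ∈ p ⁻¹' C, S = connectedComponentIn (p ⁻¹' C) x) ∧
    ∃ (w : ℂ) (g : ClosedGeodesic η w), IsCylinder η w C ∧ range g.toFun ⊆ C ∧
      (intersection γ₁ g.homologyClass, intersection γ₂ g.homologyClass) = k ∧
      ENNReal.ofReal ε < η.area C ∧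
      |Real.cos θ * w.im - Real.sin θ * w.re| ≤ (1 - ε) * ((η.area C).toReal / (2 * ‖w‖))}.Infinite

end Cover

end TranslationSurface

end

/-!
The proof is the essential value argument for skew products, carried out on the surface itself.

Let `A` be an invariant set of the flow on the cover. For a deck transformation `k` the set `B` of
the points where `A` and its translate by `k` differ is invariant, and so is its image in the
base because trajectories lift; by ergodicity of the base the image has zero or full area
(`IsZ2Cover.image_null_or_conull`). The heart of the matter is that it has zero area if the
direction `θ` is well approximated by strips producing `k` (`IsZ2Cover.area_image_eq_zero`).

A cylinder `C` with displacement vector `w` is the image of a flat strip of period `w`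
(`IsCylinder.exists_strip`). Let `T` be the component of `w` along `θ`. On the part of `C` that does
not leave the cylinder, flowing for the time `T` in the direction `θ` is the same as displacing the
point by a small vector `d`, of length `|θ ∧ w|`. In the cover the flow also goes once around the
strip, so it ends at the displaced point translated by `k` (`IsZ2Cover.exists_return`). The points
of `C` that leave the cylinder fill an area of at most `‖w‖ |θ ∧ w|`, which is at most half of the
area of `C` by the approximation property. A compact surface has only finitely many cylinders of
area bounded below and of bounded circumference (`finite_short_cylinders`), so strips exist with
`|θ ∧ w|` as small as desired. Invariance of `A` under the return map says that `x` and the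
translate by `k` of the displaced point lie on the same side of `A`, whereas `x ∈ B` says that `x`
and its own translate by `k` do not. As translations are continuous in measure, such points fill a
small area of any finite number of flat discs (`IsZ2Cover.eventually_area_le`). If the image of `B`
had full area, they would have to fill at least half of the area of the cylinder, a contradiction.

Hence `A` is invariant up to null sets under generators of the deck group, and almost every fibre
lies on one side of `A`. If neither `A` nor its complement were null, the images of both would have
full area, and almost every fibre would meet both (`IsZ2Cover.isErgodicDirection`).

The only tool is the notion of a developed map (`AbelianDifferential.IsDeveloped`), which treats
segments, trajectories, closed geodesics and strips alike: such maps are determined by their value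
at one point, they lift to the cover, and in natural coordinates they are affine. Of the homology
of the surface only the monodromy of core curves is needed.
-/

namespace TranslationSurface

open MeasureTheory Set Filter Topology

/-! ### Natural coordinates -/

section NaturalCharts

variable {X : Type*} [TopologicalSpace X] [ChartedSpace ℂ X]

namespace AbelianDifferential

variable (η : AbelianDifferential X)

/-- The coefficient `f` of `η = f(z) dz` in the chart `φ`, as a function of `z` in the target. -/
noncomputable def coeff (φ : OpenPartialHomeomorph X ℂ) (z : ℂ) : ℂ :=
  η.form (φ.symm z) (mfderiv 𝓘(ℂ, ℂ) 𝓘(ℂ, ℂ) φ.symm z (1 : ℂ))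

/-- A natural coordinate whose domain avoids the zeros of the differential. -/
def IsRegularChart (e : OpenPartialHomeomorph X ℂ) : Prop :=
  η.IsNaturalChart e ∧ ∀ x ∈ e.source, x ∉ η.zeros

theorem form_apply (x : X) (v : ℂ) : η.form x v = v * η.form x (1 : ℂ) := by
  have key : ∀ L : ℂ →L[ℂ] ℂ, L v = v * L 1 := fun L => by
    simpa only [smul_eq_mul, mul_one] using L.map_smul v (1 : ℂ)
  exact key (η.form x)

theorem form_one_ne_zero {x : X} (hx : x ∉ η.zeros) : η.form x (1 : ℂ) ≠ 0 := by
  intro h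
  apply hx
  have key : ∀ L : ℂ →L[ℂ] ℂ, L 1 = 0 → L = 0 := fun L hL => by ext; simpa using hL
  exact key (η.form x) h

variable {η}

/-- The coordinate change from a chart to a natural coordinate has the coefficient of `η` as its
derivative. -/
theorem IsNaturalChart.hasDerivAt_comp_symm [IsManifold 𝓘(ℂ, ℂ) ω X]
    {e φ : OpenPartialHomeomorph X ℂ} (he : η.IsNaturalChart e) (hφ : φ ∈ atlas ℂ X)
    {z : ℂ} (hz : z ∈ φ.target) (hze : φ.symm z ∈ e.source) :
    HasDerivAt (e ∘ φ.symm) (η.coeff φ z) z := by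
  have : IsManifold 𝓘(ℂ, ℂ) 1 X := IsManifold.of_le (n := ω) (by simp)
  have h1 : HasMFDerivAt 𝓘(ℂ, ℂ) 𝓘(ℂ, ℂ) φ.symm z (mfderiv 𝓘(ℂ, ℂ) 𝓘(ℂ, ℂ) φ.symm z) :=
    (mdifferentiableAt_atlas_symm hφ hz).hasMFDerivAt
  have h2 := (he _ hze).comp z h1
  have key : ∀ L : ℂ →L[ℂ] ℂ, HasMFDerivAt 𝓘(ℂ, ℂ) 𝓘(ℂ, ℂ) (e ∘ φ.symm) z L →
      HasDerivAt (e ∘ φ.symm) (L 1) z := fun L hL => by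
    have h3 : HasFDerivAt (e ∘ φ.symm) L z := hasMFDerivAt_iff_hasFDerivAt.1 hL
    exact h3.hasDerivAt
  exact key _ h2

/-- Two natural coordinates differ by a translation near any common point. -/
theorem IsNaturalChart.eventually_sub_eq [IsManifold 𝓘(ℂ, ℂ) ω X]
    {e e' : OpenPartialHomeomorph X ℂ} (he : η.IsNaturalChart e) (he' : η.IsNaturalChart e')
    {x : X} (hx : x ∈ e.source) (hx' : x ∈ e'.source) :
    ∀ᶠ y in 𝓝 x, e' y - e' x = e y - e x := by
  set φ := chartAt ℂ x with hφ
  have hxφ : x ∈ φ.source := mem_chart_source ℂ x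
  set V := φ.symm ⁻¹' (e.source ∩ e'.source) ∩ φ.target with hV
  have hVo : IsOpen V := by
    rw [hV, inter_comm]
    exact φ.symm.isOpen_inter_preimage (e.open_source.inter e'.open_source)
  have hxV : φ x ∈ V := ⟨by simp [φ.left_inv hxφ, hx, hx'], φ.map_source hxφ⟩
  obtain ⟨r, hr, hb⟩ := Metric.isOpen_iff.1 hVo _ hxV
  have hd : ∀ z ∈ Metric.ball (φ x) r,
      HasDerivAt (fun z => e' (φ.symm z) - e (φ.symm z)) 0 z := fun z hz => by
    have h := hb hz
    have h1 := (he'.hasDerivAt_comp_symm (chart_mem_atlas ℂ x) h.2 h.1.2).sub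
      (he.hasDerivAt_comp_symm (chart_mem_atlas ℂ x) h.2 h.1.1)
    rw [sub_self] at h1
    exact h1
  have hc : ∀ z ∈ Metric.ball (φ x) r,
      e' (φ.symm z) - e (φ.symm z) = e' x - e x := fun z hz => by
    have := Metric.isOpen_ball.is_const_of_deriv_eq_zero
      (convex_ball (φ x) r).isPreconnected
      (fun z hz => (hd z hz).differentiableAt.differentiableWithinAt)
      (fun z hz => (hd z hz).deriv) hz (Metric.mem_ball_self hr)
    simpa [φ.left_inv hxφ] using this
  have hcont : ContinuousAt φ x := φ.continuousAt hxφ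
  filter_upwards [hcont (Metric.ball_mem_nhds _ hr), φ.open_source.mem_nhds hxφ] with y hy hyφ
  have := hc _ hy
  rw [φ.left_inv hyφ] at this
  linear_combination this

/-- In a chart `φ` the form is `f dφ`. -/
theorem coeff_mul_mfderiv [IsManifold 𝓘(ℂ, ℂ) ω X] (η : AbelianDifferential X)
    {φ : OpenPartialHomeomorph X ℂ} (hφ : φ ∈ atlas ℂ X) {x : X} (hx : x ∈ φ.source)
    {L : ℂ →L[ℂ] ℂ} (hL : HasMFDerivAt 𝓘(ℂ, ℂ) 𝓘(ℂ, ℂ) φ x L) (v : ℂ) :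
    η.coeff φ (φ x) * L v = η.form x v := by
  have : IsManifold 𝓘(ℂ, ℂ) 1 X := IsManifold.of_le (n := ω) (by simp)
  have h := (mdifferentiable_of_mem_atlas (I := 𝓘(ℂ, ℂ)) hφ).symm_comp_deriv hx
  rw [hL.mfderiv] at h
  have key : ∀ K : ℂ →L[ℂ] ℂ, K.comp L = ContinuousLinearMap.id ℂ ℂ → ∀ F : ℂ →L[ℂ] ℂ,
      F (K 1) * L v = F v := fun K hK F => by
    have h1 : ∀ (K : ℂ →L[ℂ] ℂ) v, K v = v * K 1 := fun K v => by
      simpa only [smul_eq_mul, mul_one] using K.map_smul v (1 : ℂ)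
    have h2 : K (L v) = v := congrArg (fun T : ℂ →L[ℂ] ℂ => T v) hK
    rw [h1 K] at h2
    rw [h1 F (K 1), h1 F v]
    linear_combination F 1 * h2
  have h2 := key _ h (η.form (φ.symm (φ x)))
  refine h2.trans ?_
  rw [φ.left_inv hx]
  rfl

theorem coeff_eq_zero_iff [IsManifold 𝓘(ℂ, ℂ) ω X] {φ : OpenPartialHomeomorph X ℂ}
    (hφ : φ ∈ atlas ℂ X) {x : X} (hx : x ∈ φ.source) :
    η.coeff φ (φ x) = 0 ↔ x ∈ η.zeros := by
  constructor
  · intro h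
    by_contra hn
    apply η.form_one_ne_zero hn
    have : IsManifold 𝓘(ℂ, ℂ) 1 X := IsManifold.of_le (n := ω) (by simp)
    have := η.coeff_mul_mfderiv hφ hx (mdifferentiableAt_atlas hφ hx).hasMFDerivAt 1
    rw [h, zero_mul] at this
    exact this.symm
  · intro h
    have h' : η.form x = 0 := h
    simp only [coeff]
    rw [φ.left_inv hx, h']
    rfl

/-- Near a regular point a primitive of the coefficient of `η` is a natural coordinate. -/
theorem exists_isRegularChart [IsManifold 𝓘(ℂ, ℂ) ω X] (η : AbelianDifferential X)
    {x : X} (hx : x ∉ η.zeros) :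
    ∃ e, η.IsRegularChart e ∧ x ∈ e.source := by
  have : IsManifold 𝓘(ℂ, ℂ) 1 X := IsManifold.of_le (n := ω) (by simp)
  set φ := chartAt ℂ x with hφd
  have hφ : φ ∈ atlas ℂ X := chart_mem_atlas ℂ x
  have hxφ : x ∈ φ.source := mem_chart_source ℂ x
  have hol : DifferentiableOn ℂ (η.coeff φ) φ.target := η.holomorphic φ hφ
  have hne : η.coeff φ (φ x) ≠ 0 := fun h => hx ((coeff_eq_zero_iff hφ hxφ).1 h)
  have hcont : ContinuousAt (η.coeff φ) (φ x) :=
    (hol.continuousOn).continuousAt (φ.open_target.mem_nhds (φ.map_source hxφ))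
  obtain ⟨r, hr, hb⟩ := Metric.mem_nhds_iff.1 (inter_mem
    (φ.open_target.mem_nhds (φ.map_source hxφ)) (hcont.eventually_ne hne))
  obtain ⟨g, hg⟩ := (hol.mono fun z hz => (hb hz).1).isExactOn_ball (c := φ x) (r := r)
  have hgd : DifferentiableOn ℂ g (Metric.ball (φ x) r) :=
    fun z hz => (hg z hz).differentiableAt.differentiableWithinAt
  have hstrict : HasStrictDerivAt g (η.coeff φ (φ x)) (φ x) := by
    have h1 : ContDiffAt ℂ 1 g (φ x) :=
      (hgd.contDiffOn Metric.isOpen_ball).contDiffAt (Metric.ball_mem_nhds _ hr)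
    exact h1.hasStrictDerivAt' (hg _ (Metric.mem_ball_self hr)) (by simp)
  set ψ := (hstrict.hasStrictFDerivAt_equiv hne).toOpenPartialHomeomorph g with hψ
  have hψg : (ψ : ℂ → ℂ) = g := HasStrictFDerivAt.toOpenPartialHomeomorph_coe _
  have hψs : φ x ∈ ψ.source := HasStrictFDerivAt.mem_toOpenPartialHomeomorph_source _
  set ψ' := ψ.restrOpen (Metric.ball (φ x) r) Metric.isOpen_ball
  have hψ's : ψ'.source = ψ.source ∩ Metric.ball (φ x) r := rfl
  have hψ'g : (ψ' : ℂ → ℂ) = g := hψg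
  refine ⟨φ.trans ψ', ⟨fun y hy => ?_, fun y hy => ?_⟩, ?_⟩
  · rw [OpenPartialHomeomorph.trans_source, hψ's] at hy
    have h1 : HasMFDerivAt 𝓘(ℂ, ℂ) 𝓘(ℂ, ℂ) φ y (mfderiv 𝓘(ℂ, ℂ) 𝓘(ℂ, ℂ) φ y) :=
      (mdifferentiableAt_atlas hφ hy.1).hasMFDerivAt
    have h2 := (hasMFDerivAt_iff_hasFDerivAt.2 (hg _ hy.2.2).hasFDerivAt).comp y h1
    have hc : ((φ.trans ψ' : OpenPartialHomeomorph X ℂ) : X → ℂ) = g ∘ φ := by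
      rw [OpenPartialHomeomorph.coe_trans, hψ'g]
    rw [hc]
    have key : ∀ L F : ℂ →L[ℂ] ℂ, (∀ v, η.coeff φ (φ y) * L v = F v) →
        (ContinuousLinearMap.toSpanSingleton ℂ (η.coeff φ (φ y))).comp L = F := fun L F h => by
      ext
      simp [← h, mul_comm]
    have h3 := key _ _ (η.coeff_mul_mfderiv hφ hy.1 h1)
    rw [← h3]
    exact h2
  · rw [OpenPartialHomeomorph.trans_source, hψ's] at hy
    intro h0
    exact (hb hy.2.2).2 ((coeff_eq_zero_iff hφ hy.1).2 h0)
  · rw [OpenPartialHomeomorph.trans_source, hψ's]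
    exact ⟨hxφ, hψs, Metric.mem_ball_self hr⟩

theorem isClosed_zeros [IsManifold 𝓘(ℂ, ℂ) ω X] (η : AbelianDifferential X) :
    IsClosed η.zeros := by
  rw [← isOpen_compl_iff, isOpen_iff_mem_nhds]
  intro x hx
  obtain ⟨e, he, hxe⟩ := η.exists_isRegularChart hx
  exact mem_of_superset (e.open_source.mem_nhds hxe) he.2

/-- A complex differentiable map between Riemann surfaces is real differentiable, with the same
derivative. -/
theorem _root_.HasMFDerivAt.restrictScalars_real {Y : Type*} [TopologicalSpace Y]
    [ChartedSpace ℂ Y] {f : X → Y} {x : X} {L : ℂ →L[ℂ] ℂ}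
    (h : HasMFDerivAt 𝓘(ℂ, ℂ) 𝓘(ℂ, ℂ) f x L) :
    HasMFDerivAt 𝓘(ℝ, ℂ) 𝓘(ℝ, ℂ) f x (L.restrictScalars ℝ) :=
  ⟨h.1, h.2.restrictScalars ℝ⟩

/-- The inverse of a natural coordinate is differentiable at regular points, and takes the constant
vector field `w` to `η.field w`. -/
theorem IsRegularChart.hasMFDerivAt_symm [IsManifold 𝓘(ℂ, ℂ) ω X]
    {e : OpenPartialHomeomorph X ℂ} (he : η.IsRegularChart e) {z : ℂ} (hz : z ∈ e.target) :
    ∃ L : ℂ →L[ℂ] ℂ, HasMFDerivAt 𝓘(ℂ, ℂ) 𝓘(ℂ, ℂ) e.symm z L ∧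
      ∀ w : ℂ, L w = η.field w (e.symm z) := by
  have : IsManifold 𝓘(ℂ, ℂ) 1 X := IsManifold.of_le (n := ω) (by simp)
  set x := e.symm z with hx
  have hxe : x ∈ e.source := e.map_target hz
  set φ := chartAt ℂ x with hφd
  have hφ : φ ∈ atlas ℂ X := chart_mem_atlas ℂ x
  have hxφ : x ∈ φ.source := mem_chart_source ℂ x
  have hne : η.coeff φ (φ x) ≠ 0 := fun h => he.2 x hxe ((coeff_eq_zero_iff hφ hxφ).1 h)
  set ψ := e.symm.trans φ with hψ
  have hzψ : z ∈ ψ.source := by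
    rw [hψ, OpenPartialHomeomorph.trans_source]
    exact ⟨hz, hxφ⟩
  have hd : HasDerivAt ψ.symm (η.coeff φ (φ x)) (φ x) := by
    have := he.1.hasDerivAt_comp_symm hφ (φ.map_source hxφ) (by rwa [φ.left_inv hxφ])
    convert! this using 1
  have hd2 : HasDerivAt ψ (η.coeff φ (φ x))⁻¹ z := by
    have h1 : ψ z = φ x := rfl
    have h2 : ψ.symm (ψ z) = z := ψ.left_inv hzψ
    have := ψ.symm.hasDerivAt_symm (a := z) (f' := η.coeff φ (φ x)) hzψ hne (by
      rw [OpenPartialHomeomorph.symm_symm, h1]; exact hd)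
    exact this
  have hm : MDifferentiableAt 𝓘(ℂ, ℂ) 𝓘(ℂ, ℂ) e.symm z := by
    have h1 : HasMFDerivAt 𝓘(ℂ, ℂ) 𝓘(ℂ, ℂ) φ.symm (φ x) (mfderiv 𝓘(ℂ, ℂ) 𝓘(ℂ, ℂ) φ.symm (φ x)) :=
      (mdifferentiableAt_atlas_symm hφ (φ.map_source hxφ)).hasMFDerivAt
    have h2 := h1.comp (f := ψ) z (hasMFDerivAt_iff_hasFDerivAt.2 hd2.hasFDerivAt)
    refine (h2.congr_of_eventuallyEq ?_).mdifferentiableAt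
    filter_upwards [ψ.open_source.mem_nhds hzψ] with y hy
    rw [hψ, OpenPartialHomeomorph.trans_source] at hy
    exact (φ.left_inv hy.2).symm
  refine ⟨mfderiv 𝓘(ℂ, ℂ) 𝓘(ℂ, ℂ) e.symm z, hm.hasMFDerivAt, fun w => ?_⟩
  have h3 := (he.1 x hxe).comp z hm.hasMFDerivAt
  have h4 : HasMFDerivAt 𝓘(ℂ, ℂ) 𝓘(ℂ, ℂ) (e ∘ e.symm) z (ContinuousLinearMap.id ℂ ℂ) := by
    refine (hasMFDerivAt_id z).congr_of_eventuallyEq ?_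
    filter_upwards [e.open_target.mem_nhds hz] with y hy
    exact e.right_inv hy
  have h5 := congrArg (fun L => (L w : ℂ)) (hasMFDerivAt_unique h3 h4)
  have h6 : η.form x (mfderiv 𝓘(ℂ, ℂ) 𝓘(ℂ, ℂ) e.symm z w) = w := h5
  exact eq_div_of_mul_eq (η.form_one_ne_zero (he.2 x hxe)) ((η.form_apply x _).symm.trans h6)

end AbelianDifferential

end NaturalCharts

/-! ### Developed maps -/

section Developed

variable {X : Type*} [TopologicalSpace X] [ChartedSpace ℂ X]
  {E : Type*} [NormedAddCommGroup E] [NormedSpace ℝ E]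
  {E' : Type*} [NormedAddCommGroup E'] [NormedSpace ℝ E']

namespace AbelianDifferential

/-- `f` is developed on `S` with linear part `L`: it avoids the zeros of `η` and near every point
of `S`, in a natural coordinate, it is affine with linear part `L`. Straight segments
(`E = ℝ`) and flat strips (`E = ℂ`) on the translation surface are maps of this kind. -/
def IsDeveloped (η : AbelianDifferential X) (L : E →L[ℝ] ℂ) (f : E → X) (S : Set E) : Prop :=
  ∀ z ∈ S, ∃ e, η.IsRegularChart e ∧ f z ∈ e.source ∧
    ∀ᶠ z' in 𝓝[S] z, f z' ∈ e.source ∧ e (f z') = e (f z) + L (z' - z)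

variable {η : AbelianDifferential X} {L : E →L[ℝ] ℂ} {f g : E → X} {S T : Set E}

namespace IsDeveloped

theorem notMem_zeros (hf : η.IsDeveloped L f S) {z : E} (hz : z ∈ S) : f z ∉ η.zeros := by
  obtain ⟨e, he, hfe, -⟩ := hf z hz
  exact he.2 _ hfe

theorem mono (hf : η.IsDeveloped L f S) (hT : T ⊆ S) : η.IsDeveloped L f T := fun z hz => by
  obtain ⟨e, he, hfe, h⟩ := hf z (hT hz)
  exact ⟨e, he, hfe, h.filter_mono (nhdsWithin_mono _ hT)⟩

theorem congr (hf : η.IsDeveloped L f S) (h : EqOn g f S) : η.IsDeveloped L g S := fun z hz => by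
  obtain ⟨e, he, hfe, h'⟩ := hf z hz
  refine ⟨e, he, by rwa [h hz], ?_⟩
  filter_upwards [h', self_mem_nhdsWithin] with y hy hyS
  rwa [h hz, h hyS]

theorem of_local (h : ∀ z ∈ S, ∃ T ∈ 𝓝[S] z, z ∈ T ∧ η.IsDeveloped L f T) :
    η.IsDeveloped L f S := fun z hz => by
  obtain ⟨T, hT, hzT, hf⟩ := h z hz
  obtain ⟨e, he, hfe, h'⟩ := hf z hzT
  exact ⟨e, he, hfe, h'.filter_mono (nhdsWithin_le_of_mem hT)⟩

theorem continuousOn (hf : η.IsDeveloped L f S) : ContinuousOn f S := fun z hz => by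
  obtain ⟨e, he, hfe, h⟩ := hf z hz
  have h1 : ContinuousAt (fun z' => e.symm (e (f z) + L (z' - z))) z := by
    apply ContinuousAt.comp (g := e.symm) (f := fun z' => e (f z) + L (z' - z))
    · simpa using e.symm.continuousAt (e.map_source hfe)
    · fun_prop
  refine h1.continuousWithinAt.congr_of_eventuallyEq ?_ (by simp [e.left_inv hfe])
  filter_upwards [h] with y hy
  rw [← hy.2, e.left_inv hy.1]

/-- The condition on a developed map holds in every natural coordinate. -/
theorem eventually_chart [IsManifold 𝓘(ℂ, ℂ) ω X] (hf : η.IsDeveloped L f S) {z : E} (hz : z ∈ S)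
    {e : OpenPartialHomeomorph X ℂ} (he : η.IsNaturalChart e) (hfe : f z ∈ e.source) :
    ∀ᶠ z' in 𝓝[S] z, f z' ∈ e.source ∧ e (f z') = e (f z) + L (z' - z) := by
  obtain ⟨e', he', hfe', h⟩ := hf z hz
  have hc : Tendsto f (𝓝[S] z) (𝓝 (f z)) := hf.continuousOn z hz
  filter_upwards [h, hc (e.open_source.mem_nhds hfe),
    hc (he'.1.eventually_sub_eq he hfe' hfe)] with y hy hy2 hy3
  refine ⟨hy2, ?_⟩
  have : e (f y) - e (f z) = e' (f y) - e' (f z) := hy3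
  linear_combination this + hy.2

theorem comp {L' : E' →L[ℝ] ℂ} {S' : Set E'} {φ : E' → E} (hf : η.IsDeveloped L f S)
    (hφ : ContinuousOn φ S') (hm : MapsTo φ S' S)
    (hL : ∀ z ∈ S', ∀ z' ∈ S', L (φ z' - φ z) = L' (z' - z)) :
    η.IsDeveloped L' (f ∘ φ) S' := fun z hz => by
  obtain ⟨e, he, hfe, h⟩ := hf (φ z) (hm hz)
  refine ⟨e, he, hfe, ?_⟩
  have ht : Tendsto φ (𝓝[S'] z) (𝓝[S] (φ z)) := (hφ z hz).tendsto_nhdsWithin hm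
  filter_upwards [ht.eventually h, self_mem_nhdsWithin] with y hy hyS
  rw [← hL z hz y hyS]
  exact hy

/-- Developed maps on a connected set are determined by their value at a point. -/
theorem eqOn [IsManifold 𝓘(ℂ, ℂ) ω X] [T2Space X] (hf : η.IsDeveloped L f S)
    (hg : η.IsDeveloped L g S) (hS : IsPreconnected S) {z₀ : E} (hz₀ : z₀ ∈ S)
    (h₀ : f z₀ = g z₀) : EqOn f g S := by
  have : PreconnectedSpace S := Subtype.preconnectedSpace hS
  have hcl : IsClopen {z : S | f z = g z} := by
    refine ⟨isClosed_eq hf.continuousOn.domRestrict hg.continuousOn.domRestrict, ?_⟩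
    rw [isOpen_iff_mem_nhds]
    rintro ⟨z, hz⟩ (hfg : f z = g z)
    obtain ⟨e, he, hfe, h⟩ := hf z hz
    have h' := hg.eventually_chart hz he.1 (hfg ▸ hfe)
    rw [nhds_subtype_eq_comap_nhdsWithin]
    refine ⟨_, h.and h', ?_⟩
    rintro ⟨y, hy⟩ ⟨⟨h1, h2⟩, h3, h4⟩
    refine e.injOn h1 h3 ?_
    change e (f y) = e (g y)
    rw [h2, h4, hfg]
  have := hcl.eq_univ ⟨⟨z₀, hz₀⟩, h₀⟩
  intro z hz
  exact (this ▸ mem_univ _ : (⟨z, hz⟩ : S) ∈ {z : S | f z = g z})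

end IsDeveloped

/-- The inverse of a natural coordinate, precomposed with an affine map. -/
theorem IsRegularChart.isDeveloped_symm {e : OpenPartialHomeomorph X ℂ} (he : η.IsRegularChart e)
    (L : E →L[ℝ] ℂ) (c : ℂ) :
    η.IsDeveloped L (fun z => e.symm (c + L z)) {z | c + L z ∈ e.target} := fun z hz => by
  refine ⟨e, he, e.map_target hz, ?_⟩
  filter_upwards [self_mem_nhdsWithin] with y hy
  refine ⟨e.map_target hy, ?_⟩
  rw [e.right_inv hz, e.right_inv hy, map_sub]
  ring

/-- The linear map `t ↦ t • w`. -/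
noncomputable abbrev line (w : ℂ) : ℝ →L[ℝ] ℂ := ContinuousLinearMap.toSpanSingleton ℝ w

/-- Multiplication by `w`, as a real-linear map. -/
noncomputable abbrev scale (w : ℂ) : ℂ →L[ℝ] ℂ := ContinuousLinearMap.mul ℝ ℂ w

theorem isDeveloped_of_isMIntegralCurveOn [IsManifold 𝓘(ℂ, ℂ) ω X] {w : ℂ} {c : ℝ → X} {S : Set ℝ}
    (hS : Convex ℝ S) (hc : IsMIntegralCurveOn c (η.field w) S) (hr : ∀ t ∈ S, c t ∉ η.zeros) :
    η.IsDeveloped (line w) c S := fun t ht => by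
  obtain ⟨e, he, hte⟩ := η.exists_isRegularChart (hr t ht)
  refine ⟨e, he, hte, ?_⟩
  have hcont : Tendsto c (𝓝[S] t) (𝓝 (c t)) := hc.continuousWithinAt ht
  obtain ⟨r, hr0, hrb⟩ := Metric.mem_nhdsWithin_iff.1 (hcont (e.open_source.mem_nhds hte))
  have hder : ∀ s ∈ Metric.ball t r ∩ S, HasDerivWithinAt (fun s => e (c s) - s • w) 0
      (Metric.ball t r ∩ S) s := fun s hs => by
    have h1 : HasMFDerivWithinAt 𝓘(ℝ, ℝ) 𝓘(ℝ, ℂ) c S s _ := hc s hs.2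
    have h2 : HasMFDerivAt 𝓘(ℝ, ℂ) 𝓘(ℝ, ℂ) e (c s) _ :=
      (he.1 (c s) (hrb hs)).restrictScalars_real
    have h3 : HasMFDerivWithinAt 𝓘(ℝ, ℝ) 𝓘(ℝ, ℂ) (e ∘ c) S s _ := h2.comp_hasMFDerivWithinAt s h1
    have key : ∀ K : ℝ →L[ℝ] ℂ, HasMFDerivWithinAt 𝓘(ℝ, ℝ) 𝓘(ℝ, ℂ) (e ∘ c) S s K →
        HasDerivWithinAt (e ∘ c) (K 1) S s := fun K hK => by
      have h3 : HasFDerivWithinAt (e ∘ c) K S s := hasMFDerivWithinAt_iff_hasFDerivWithinAt.1 hK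
      exact h3.hasDerivWithinAt
    have h4 : HasDerivWithinAt (e ∘ c) w S s := by
      convert! key _ h3 using 1
      have : η.form (c s) (((1 : ℝ) • (η.field w (c s)) : ℂ)) = w := by
        rw [one_smul]
        exact η.form_field w (he.2 _ (hrb hs))
      exact this.symm
    have h5 := (h4.mono inter_subset_right : HasDerivWithinAt _ w (Metric.ball t r ∩ S) s).sub
      (((hasDerivAt_id s).smul_const w).hasDerivWithinAt (s := Metric.ball t r ∩ S))
    rw [one_smul, sub_self] at h5
    exact h5
  filter_upwards [self_mem_nhdsWithin, mem_nhdsWithin_of_mem_nhds (Metric.ball_mem_nhds t hr0)]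
    with s hsS hs
  refine ⟨hrb ⟨hs, hsS⟩, ?_⟩
  have := Convex.norm_image_sub_le_of_norm_hasDerivWithin_le (C := 0) hder (by simp)
    ((convex_ball t r).inter hS) ⟨Metric.mem_ball_self hr0, ht⟩ ⟨hs, hsS⟩
  rw [zero_mul, norm_le_zero_iff] at this
  simp only [ContinuousLinearMap.toSpanSingleton_apply, sub_smul]
  linear_combination this

theorem IsDeveloped.isMIntegralCurveOn [IsManifold 𝓘(ℂ, ℂ) ω X] {w : ℂ} {c : ℝ → X} {S : Set ℝ}
    (hc : η.IsDeveloped (line w) c S) : IsMIntegralCurveOn c (η.field w) S := fun t ht => by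
  obtain ⟨e, he, hte, h⟩ := hc t ht
  obtain ⟨K, hK, hKw⟩ := he.hasMFDerivAt_symm (e.map_source hte)
  have h1 : HasMFDerivAt 𝓘(ℝ, ℂ) 𝓘(ℝ, ℂ) e.symm (e (c t)) (K.restrictScalars ℝ) :=
    hK.restrictScalars_real
  have h2 : HasMFDerivWithinAt 𝓘(ℝ, ℝ) 𝓘(ℝ, ℂ) (fun s : ℝ => e (c t) + line w (s - t)) S t
      (line w) := by
    refine hasMFDerivWithinAt_iff_hasFDerivWithinAt.2 ?_
    have : HasFDerivAt (fun s : ℝ => e (c t) + line w (s - t)) (line w) t :=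
      ((line w).hasFDerivAt.comp (f := fun s : ℝ => s - t) t
        ((hasFDerivAt_id t).sub_const t)).const_add _
    exact this.hasFDerivWithinAt
  have h3 : ∀ z, z = e (c t) → HasMFDerivAt 𝓘(ℝ, ℂ) 𝓘(ℝ, ℂ) e.symm z
      (K.restrictScalars ℝ : ℂ →L[ℝ] ℂ) := by
    rintro _ rfl
    exact h1
  have h4 := (h3 (e (c t) + line w (t - t)) (by simp)).comp_hasMFDerivWithinAt t h2
  have h5 := h4.congr_of_eventuallyEq (f₁ := c) (by
    filter_upwards [h] with y hy
    simp only [Function.comp]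
    rw [← hy.2, e.left_inv hy.1]) (by simp [e.left_inv hte])
  have key : ∀ A B : ℝ →L[ℝ] ℂ, A 1 = B 1 → HasMFDerivWithinAt 𝓘(ℝ, ℝ) 𝓘(ℝ, ℂ) c S t A →
      HasMFDerivWithinAt 𝓘(ℝ, ℝ) 𝓘(ℝ, ℂ) c S t B := fun A B hAB hA => by
    have : A = B := by ext; exact hAB
    rwa [← this]
  refine key _ _ ?_ h5
  have h6 := hKw ((1 : ℝ) • w)
  rw [e.left_inv hte] at h6
  refine h6.trans ?_
  rw [one_smul]
  exact (one_smul ℝ (η.field w (c t) : ℂ)).symm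

theorem flowsTo_iff [IsManifold 𝓘(ℂ, ℂ) ω X] {θ t : ℝ} {x y : X} :
    η.FlowsTo θ t x y ↔ ∃ c : ℝ → X, c 0 = x ∧ c t = y ∧
      η.IsDeveloped (line (Complex.exp (θ * Complex.I))) c (uIcc 0 t) := by
  constructor
  · rintro ⟨c, h0, h1, hr, hc⟩
    exact ⟨c, h0, h1, isDeveloped_of_isMIntegralCurveOn (convex_uIcc 0 t) hc hr⟩
  · rintro ⟨c, h0, h1, hc⟩
    exact ⟨c, h0, h1, fun s hs => hc.notMem_zeros hs, hc.isMIntegralCurveOn⟩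

theorem FlowsTo.symm [IsManifold 𝓘(ℂ, ℂ) ω X] {θ t : ℝ} {x y : X} (h : η.FlowsTo θ t x y) :
    η.FlowsTo θ (-t) y x := by
  rw [flowsTo_iff] at h ⊢
  obtain ⟨c, h0, h1, hc⟩ := h
  refine ⟨c ∘ fun s => s + t, by simpa using h1, by simpa using h0,
    hc.comp (by fun_prop) (fun s hs => ?_) fun z _ z' _ => by simp⟩
  rw [mem_uIcc] at hs ⊢
  rcases hs with h | h
  · exact Or.inr ⟨by linarith, by linarith⟩
  · exact Or.inl ⟨by linarith, by linarith⟩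

end AbelianDifferential

end Developed

/-! ### The area measure -/

section Area

theorem _root_.OpenPartialHomeomorph.measurableSet_image {X Y : Type*} [TopologicalSpace X]
    [TopologicalSpace Y] [MeasurableSpace X] [BorelSpace X] [MeasurableSpace Y] [BorelSpace Y]
    (e : OpenPartialHomeomorph X Y) {B : Set X} (hB : MeasurableSet B) (hBe : B ⊆ e.source) :
    MeasurableSet (e '' B) := by
  have h1 : e '' B = Subtype.val '' ((e.target.domRestrict e.symm) ⁻¹' B) := by
    rw [e.image_eq_target_inter_inv_preimage hBe]
    ext z
    simp [domRestrict, and_comm]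
  rw [h1]
  exact e.open_target.measurableSet.subtype_image
    (e.continuousOn_symm.domRestrict.measurable hB)

theorem _root_.OpenPartialHomeomorph.map_symm_restrict_apply {X Y : Type*} [TopologicalSpace X]
    [TopologicalSpace Y] [MeasurableSpace X] [BorelSpace X] [MeasurableSpace Y] [BorelSpace Y]
    (e : OpenPartialHomeomorph X Y) (κ : Measure Y) {B : Set X} (hB : MeasurableSet B) :
    (κ.restrict e.target).map e.symm B = κ (e '' (B ∩ e.source)) := by
  rw [Measure.map_apply_of_aemeasurable
    (e.continuousOn_symm.aemeasurable e.open_target.measurableSet) hB,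
    Measure.restrict_apply' e.open_target.measurableSet,
    e.image_eq_target_inter_inv_preimage inter_subset_right]
  congr 1
  ext z
  constructor
  · rintro ⟨h1, h2⟩
    exact ⟨h2, h1, e.map_target h2⟩
  · rintro ⟨h2, h1, -⟩
    exact ⟨h1, h2⟩

theorem det_restrictScalars_toSpanSingleton (c : ℂ) :
    ((ContinuousLinearMap.toSpanSingleton ℂ c : ℂ →L[ℂ] ℂ).restrictScalars ℝ).det = ‖c‖ ^ 2 := by
  have h : LinearMap.det ((LinearMap.toSpanSingleton ℂ ℂ c).restrictScalars ℝ) = ‖c‖ ^ 2 := by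
    rw [LinearMap.det_restrictScalars, Algebra.norm_complex_apply, Complex.normSq_eq_norm_sq]
    simp
  exact h

variable {X : Type*} [TopologicalSpace X] [ChartedSpace ℂ X]

namespace AbelianDifferential

theorem exists_chart_cover [SecondCountableTopology X] (η : AbelianDifferential X) :
    ∃ φ : ℕ → OpenPartialHomeomorph X ℂ, (∀ i, φ i ∈ atlas ℂ X) ∧ ⋃ i, (φ i).source = univ := by
  have : Nonempty X := ⟨η.nonzero.choose⟩
  obtain ⟨f, hf⟩ := (isLindelof_univ (X := X)).indexed_countable_subcover
    (fun x : X => (chartAt ℂ x).source) (fun x => (chartAt ℂ x).open_source)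
    (fun x _ => mem_iUnion.2 ⟨x, mem_chart_source ℂ x⟩)
  exact ⟨fun n => chartAt ℂ (f n), fun n => chart_mem_atlas ℂ _, univ_subset_iff.1 hf⟩

variable [MeasurableSpace X] [BorelSpace X] (η : AbelianDifferential X)

/-- The measure `|f|² dx dy` on the domain of the chart `φ` in which `η = f(z) dz`. -/
noncomputable def chartMeasure (φ : OpenPartialHomeomorph X ℂ) : Measure X :=
  ((volume.withDensity fun z => ENNReal.ofReal (‖η.coeff φ z‖ ^ 2)).restrict φ.target).map φ.symm

variable {η}

theorem chartMeasure_apply (φ : OpenPartialHomeomorph X ℂ) {B : Set X} (hB : MeasurableSet B)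
    (hBφ : B ⊆ φ.source) :
    η.chartMeasure φ B = ∫⁻ z in φ '' B, ENNReal.ofReal (‖η.coeff φ z‖ ^ 2) := by
  rw [chartMeasure, φ.map_symm_restrict_apply _ hB, inter_eq_left.2 hBφ,
    withDensity_apply _ (φ.measurableSet_image hB hBφ)]

theorem IsNaturalChart.volume_image_le_area {e : OpenPartialHomeomorph X ℂ}
    (he : η.IsNaturalChart e) {B : Set X} (hB : MeasurableSet B) :
    volume (e '' (B ∩ e.source)) ≤ η.area B := by
  rw [← e.map_symm_restrict_apply volume hB]
  exact le_iSup (fun e : {e : OpenPartialHomeomorph X ℂ // η.IsNaturalChart e} =>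
    Measure.map e.1.symm (volume.restrict e.1.target)) ⟨e, he⟩ B

variable [IsManifold 𝓘(ℂ, ℂ) ω X]

/-- Natural coordinates have Jacobian `|f|²` in the charts of the surface. -/
theorem IsNaturalChart.volume_image {e φ : OpenPartialHomeomorph X ℂ} (he : η.IsNaturalChart e)
    (hφ : φ ∈ atlas ℂ X) {B : Set X} (hB : MeasurableSet B) (hBe : B ⊆ e.source)
    (hBφ : B ⊆ φ.source) : volume (e '' B) = η.chartMeasure φ B := by
  have h1 : e '' B = (e ∘ φ.symm) '' (φ '' B) := by
    rw [← image_comp]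
    refine image_congr fun x hx => ?_
    simp [φ.left_inv (hBφ hx)]
  rw [chartMeasure_apply φ hB hBφ, h1, ← lintegral_abs_det_fderiv_eq_addHaar_image volume
    (φ.measurableSet_image hB hBφ) (f' := fun z =>
      (ContinuousLinearMap.toSpanSingleton ℂ (η.coeff φ z)).restrictScalars ℝ)]
  · simp only [det_restrictScalars_toSpanSingleton, abs_pow, abs_norm]
  · rintro _ ⟨x, hx, rfl⟩
    exact ((he.hasDerivAt_comp_symm hφ (φ.map_source (hBφ hx))
      (by rw [φ.left_inv (hBφ hx)]; exact hBe hx)).hasFDerivAt.restrictScalars ℝ).hasFDerivWithinAt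
  · rintro _ ⟨x, hx, rfl⟩ _ ⟨y, hy, rfl⟩ hxy
    simp only [Function.comp, φ.left_inv (hBφ hx), φ.left_inv (hBφ hy)] at hxy
    rw [e.injOn (hBe hx) (hBe hy) hxy]

/-- The area is at most the sum of the measures `|f|² dx dy` over charts that cover the surface. -/
theorem area_le_sum {ι : Type*} [Countable ι] {φ : ι → OpenPartialHomeomorph X ℂ}
    (hφ : ∀ i, φ i ∈ atlas ℂ X) {O : ι → Set X} (hO : ∀ i, MeasurableSet (O i))
    (hOφ : ∀ i, O i ⊆ (φ i).source) (hcov : ⋃ i, O i = univ) :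
    η.area ≤ Measure.sum fun i => (η.chartMeasure (φ i)).restrict (O i) := by
  refine iSup_le fun ⟨e, he⟩ => Measure.le_iff.2 fun B hB => ?_
  rw [e.map_symm_restrict_apply volume hB, Measure.sum_apply _ hB]
  have h1 : e '' (B ∩ e.source) = ⋃ i, e '' (B ∩ e.source ∩ O i) := by
    rw [← image_iUnion, ← inter_iUnion, hcov, inter_univ]
  rw [h1]
  refine (measure_iUnion_le _).trans (ENNReal.tsum_le_tsum fun i => ?_)
  rw [he.volume_image (hφ i) ((hB.inter e.open_source.measurableSet).inter (hO i))
    (fun x hx => hx.1.2) (fun x hx => hOφ i hx.2), Measure.restrict_apply hB]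
  exact measure_mono fun x hx => ⟨hx.1.1, hx.2⟩

/-- The area is Lebesgue measure in every natural coordinate. -/
theorem IsNaturalChart.area_eq [SecondCountableTopology X] {e : OpenPartialHomeomorph X ℂ}
    (he : η.IsNaturalChart e) {B : Set X} (hB : MeasurableSet B) (hBe : B ⊆ e.source) :
    η.area B = volume (e '' B) := by
  refine le_antisymm ?_ ?_
  · obtain ⟨φ, hφ, hcov⟩ := η.exists_chart_cover
    set O := disjointed fun i => (φ i).source with hO
    have hOφ : ∀ i, O i ⊆ (φ i).source := fun i => disjointed_le _ i
    have hOm : ∀ i, MeasurableSet (O i) :=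
      MeasurableSet.disjointed fun i => (φ i).open_source.measurableSet
    have hOcov : ⋃ i, O i = univ := by rw [hO, iUnion_disjointed, hcov]
    refine (area_le_sum hφ hOm hOφ hOcov B).trans ?_
    rw [Measure.sum_apply _ hB]
    have h1 : e '' B = ⋃ i, e '' (B ∩ O i) := by
      rw [← image_iUnion, ← inter_iUnion, hOcov, inter_univ]
    rw [h1, measure_iUnion]
    · refine ENNReal.tsum_le_tsum fun i => ?_
      rw [he.volume_image (hφ i) (hB.inter (hOm i)) (fun x hx => hBe hx.1)
        (fun x hx => hOφ i hx.2), Measure.restrict_apply hB]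
    · intro i j hij
      rw [Function.onFun, Set.disjoint_left]
      rintro _ ⟨x, hx, rfl⟩ ⟨y, hy, hxy⟩
      have := e.injOn (hBe hy.1) (hBe hx.1) hxy
      subst this
      exact Set.disjoint_left.1 (disjoint_disjointed _ hij) hx.2 hy.2
    · exact fun i => e.measurableSet_image (hB.inter (hOm i)) fun x hx => hBe hx.1
  · have := he.volume_image_le_area hB
    rwa [inter_eq_left.2 hBe] at this

/-- The zeros have area zero: on them the densities `|f|²` vanish. -/
theorem area_zeros [SecondCountableTopology X] (η : AbelianDifferential X) :
    η.area η.zeros = 0 := by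
  obtain ⟨φ, hφ, hcov⟩ := η.exists_chart_cover
  refine le_antisymm ((area_le_sum hφ (fun i => (φ i).open_source.measurableSet)
    (fun i => subset_rfl) hcov _).trans ?_) bot_le
  have hz := η.isClosed_zeros.measurableSet
  rw [Measure.sum_apply _ hz]
  refine (ENNReal.tsum_eq_zero.2 fun i => ?_).le
  have hm := hz.inter (φ i).open_source.measurableSet
  rw [Measure.restrict_apply hz, chartMeasure_apply _ hm inter_subset_right,
    setLIntegral_congr_fun (g := fun _ => 0) ((φ i).measurableSet_image hm inter_subset_right),
    lintegral_zero]
  rintro _ ⟨x, hx, rfl⟩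
  simp [(coeff_eq_zero_iff (hφ i) hx.2).2 hx.1]

/-- A compact translation surface has finite area. -/
theorem area_lt_top [CompactSpace X] (η : AbelianDifferential X) : η.area univ < ⊤ := by
  have h0 : ∀ x : X, ∃ K ⊆ (chartAt ℂ x).target, IsCompact K ∧ K ∈ 𝓝 (chartAt ℂ x x) := fun x => by
    obtain ⟨K, hK, hKs, hKc⟩ := LocallyCompactSpace.local_compact_nhds (chartAt ℂ x x) _
      ((chartAt ℂ x).open_target.mem_nhds (mem_chart_target ℂ x))
    exact ⟨K, hKs, hKc, hK⟩
  choose K hKt hKc hKn using h0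
  set O : X → Set X := fun x => (chartAt ℂ x).source ∩ chartAt ℂ x ⁻¹' interior (K x) with hO
  have hOo : ∀ x, IsOpen (O x) := fun x =>
    (chartAt ℂ x).isOpen_inter_preimage isOpen_interior
  have hxO : ∀ x, x ∈ O x := fun x => ⟨mem_chart_source ℂ x, mem_interior_iff_mem_nhds.2 (hKn x)⟩
  obtain ⟨t, ht⟩ := isCompact_univ.elim_finite_subcover O hOo
    fun x _ => mem_iUnion.2 ⟨x, hxO x⟩
  have hcov : ⋃ i : t, O i = univ := by
    rw [← univ_subset_iff]
    intro x hx
    simpa using ht hx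
  refine (area_le_sum (φ := fun i : t => chartAt ℂ (i : X)) (fun i => chart_mem_atlas ℂ _)
    (fun i => (hOo i).measurableSet) (fun i => inter_subset_left) hcov _).trans_lt ?_
  rw [Measure.sum_apply _ MeasurableSet.univ, tsum_fintype]
  refine ENNReal.sum_lt_top.2 fun i _ => ?_
  rw [Measure.restrict_apply MeasurableSet.univ, univ_inter,
    chartMeasure_apply _ (hOo i).measurableSet inter_subset_left]
  have hc : ContinuousOn (fun z => ‖η.coeff (chartAt ℂ (i : X)) z‖ ^ 2) (K i) :=
    (((η.holomorphic _ (chart_mem_atlas ℂ _)).continuousOn.mono (hKt i)).norm).pow 2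
  obtain ⟨C, hC⟩ := (hKc i).exists_bound_of_continuousOn hc
  calc ∫⁻ z in (chartAt ℂ (i : X)) '' O i, ENNReal.ofReal (‖η.coeff (chartAt ℂ (i : X)) z‖ ^ 2)
      ≤ ∫⁻ z in K i, ENNReal.ofReal (‖η.coeff (chartAt ℂ (i : X)) z‖ ^ 2) := by
        refine lintegral_mono_set ?_
        rintro _ ⟨x, hx, rfl⟩
        exact interior_subset hx.2
    _ ≤ ∫⁻ z in K i, ENNReal.ofReal C := by
        refine setLIntegral_mono' (hKc i).measurableSet fun z hz => ?_
        exact ENNReal.ofReal_le_ofReal ((le_abs_self _).trans (hC z hz))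
    _ < ⊤ := by
        rw [setLIntegral_const]
        exact ENNReal.mul_lt_top ENNReal.ofReal_lt_top (hKc i).measure_lt_top

end AbelianDifferential

end Area

/-! ### Flat strips -/

section Strips

variable {X : Type*} [TopologicalSpace X] [ChartedSpace ℂ X]

/-- The horizontal strip of the complex numbers with imaginary part in `I`. -/
def strip (I : Set ℝ) : Set ℂ := Complex.im ⁻¹' I

theorem isOpen_strip {I : Set ℝ} (hI : IsOpen I) : IsOpen (strip I) :=
  hI.preimage Complex.continuous_im

theorem convex_strip {I : Set ℝ} (hI : I.OrdConnected) : Convex ℝ (strip I) :=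
  hI.convex.linear_preimage Complex.imLm

theorem isPreconnected_strip {I : Set ℝ} (hI : I.OrdConnected) : IsPreconnected (strip I) :=
  (convex_strip hI).isPreconnected

namespace AbelianDifferential

variable {η : AbelianDifferential X} {w : ℂ} {F : ℂ → X} {S : Set ℂ}

/-- A developed map on a plane domain is a local homeomorphism. -/
theorem IsDeveloped.map_nhds_eq (hF : η.IsDeveloped (scale w) F S) (hw : w ≠ 0) {z : ℂ}
    (hS : S ∈ 𝓝 z) : map F (𝓝 z) = 𝓝 (F z) := by
  obtain ⟨e, he, hfe, h⟩ := hF z (mem_of_mem_nhds hS)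
  rw [nhdsWithin_eq_nhds.2 hS] at h
  have h1 : F =ᶠ[𝓝 z] e.symm ∘ fun z' => e (F z) + w * (z' - z) := by
    filter_upwards [h] with y hy
    have h2 : e (F y) = e (F z) + w * (y - z) := hy.2
    simp only [Function.comp]
    rw [← h2, e.left_inv hy.1]
  have h2 : HasStrictDerivAt (fun z' => e (F z) + w * (z' - z)) w z := by
    have h3 : HasStrictDerivAt (fun z' : ℂ => z' - z) 1 z := (hasStrictDerivAt_id z).sub_const z
    have h4 := (h3.const_mul w).const_add (e (F z))
    rwa [mul_one] at h4
  rw [Filter.map_congr h1, ← Filter.map_map, h2.map_nhds_eq hw]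
  simp only [sub_self, mul_zero, add_zero]
  rw [e.symm.map_nhds_eq (e.map_source hfe), e.left_inv hfe]

theorem IsDeveloped.isOpen_image (hF : η.IsDeveloped (scale w) F S) (hw : w ≠ 0)
    (hS : IsOpen S) : IsOpen (F '' S) := by
  rw [isOpen_iff_mem_nhds]
  rintro _ ⟨z, hz, rfl⟩
  rw [← hF.map_nhds_eq hw (hS.mem_nhds hz)]
  exact image_mem_map (hS.mem_nhds hz)

variable [IsManifold 𝓘(ℂ, ℂ) ω X]

/-- A developed map on a plane domain is a local similarity of factor `‖w‖`, so it multiplies areas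
by at most `‖w‖ ^ 2`. -/
theorem IsDeveloped.area_image_le [MeasurableSpace X] [BorelSpace X] [SecondCountableTopology X]
    (hF : η.IsDeveloped (scale w) F S) (hw : w ≠ 0) (hS : IsOpen S) {B : Set ℂ}
    (hB : MeasurableSet B) (hBS : B ⊆ S) :
    η.area (F '' B) ≤ ENNReal.ofReal (‖w‖ ^ 2) * volume B := by
  have hloc : ∀ z ∈ S, ∃ O, IsOpen O ∧ z ∈ O ∧ ∀ B', MeasurableSet B' → B' ⊆ O →
      η.area (F '' B') ≤ ENNReal.ofReal (‖w‖ ^ 2) * volume B' := fun z hz => by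
    obtain ⟨e, he, hfe, h⟩ := hF z hz
    rw [nhdsWithin_eq_nhds.2 (hS.mem_nhds hz)] at h
    obtain ⟨O, hO, hOo, hzO⟩ := mem_nhds_iff.1 h
    refine ⟨O, hOo, hzO, fun B' hB' hBO => ?_⟩
    set f : ℂ → ℂ := fun z' => e (F z) + w * (z' - z) with hf
    have hfi : InjOn f B' := fun a _ b _ hab => by
      simpa [hf, hw] using hab
    have hfm : MeasurableSet (f '' B') :=
      hB'.image_of_continuousOn_injOn (by fun_prop) hfi
    have h1 : F '' B' = e.symm '' (f '' B') := by
      rw [← image_comp]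
      refine image_congr fun y hy => ?_
      have h2 : e (F y) = f y := (hO (hBO hy)).2
      simp only [Function.comp]
      rw [← h2, e.left_inv (hO (hBO hy)).1]
    have hft : f '' B' ⊆ e.target := by
      rintro _ ⟨y, hy, rfl⟩
      have h2 : e (F y) = f y := (hO (hBO hy)).2
      rw [← h2]
      exact e.map_source (hO (hBO hy)).1
    have h2 : e '' (F '' B') = f '' B' := by
      rw [h1]
      exact e.symm.symm_image_image_of_subset_source hft
    rw [he.1.area_eq (h1 ▸ e.symm.measurableSet_image hfm hft) (by
      rw [h1]; rintro _ ⟨y, hy, rfl⟩; exact e.map_target (hft hy)), h2]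
    refine (addHaar_image_le_lintegral_abs_det_fderiv volume hB' (f' := fun _ =>
      (ContinuousLinearMap.toSpanSingleton ℂ w).restrictScalars ℝ) fun y _ => ?_).trans ?_
    · have h3 : HasDerivAt f w y := by
        have h4 := (((hasDerivAt_id y).sub_const z).const_mul w).const_add (e (F z))
        rwa [mul_one] at h4
      exact (h3.hasFDerivAt.restrictScalars ℝ).hasFDerivWithinAt
    · simp only [det_restrictScalars_toSpanSingleton, abs_pow, abs_norm]
      rw [setLIntegral_const]
  choose! O hOo hzO hO using hloc
  obtain ⟨t, ht, htS⟩ := (HereditarilyLindelofSpace.isLindelof S).elim_countable_subcover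
    (fun z : S => O z) (fun z => hOo z z.2) fun z hz => mem_iUnion.2 ⟨⟨z, hz⟩, hzO z hz⟩
  rcases t.eq_empty_or_nonempty with rfl | hne
  · have : B = ∅ := by
      rw [← subset_empty_iff]
      exact hBS.trans (by simpa using htS)
    simp [this]
  obtain ⟨f, rfl⟩ := ht.exists_eq_range hne
  set P := disjointed fun n => O (f n) with hP
  have hPO : ∀ n, P n ⊆ O (f n) := fun n => disjointed_le _ n
  have hPm : ∀ n, MeasurableSet (P n) :=
    MeasurableSet.disjointed fun n => (hOo _ (f n).2).measurableSet
  have hBP : B = ⋃ n, B ∩ P n := by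
    rw [← inter_iUnion, hP, iUnion_disjointed, eq_comm, inter_eq_left]
    refine hBS.trans (htS.trans ?_)
    simp
  calc η.area (F '' B) ≤ ∑' n, η.area (F '' (B ∩ P n)) := by
        conv_lhs => rw [hBP, image_iUnion]
        exact measure_iUnion_le _
    _ ≤ ∑' n, ENNReal.ofReal (‖w‖ ^ 2) * volume (B ∩ P n) :=
        ENNReal.tsum_le_tsum fun n => hO _ (f n).2 _ (hB.inter (hPm n))
          (inter_subset_right.trans (hPO n))
    _ = ENNReal.ofReal (‖w‖ ^ 2) * volume B := by
        rw [ENNReal.tsum_mul_left, ← measure_iUnion (fun i j hij =>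
          (disjoint_disjointed _ hij).mono inter_subset_right inter_subset_right)
          (fun n => hB.inter (hPm n)), ← hBP]

/-- A compact set of regular points has natural coordinates of a uniform size. -/
theorem exists_uniform_chart {K : Set X} (hK : IsCompact K) (hreg : ∀ x ∈ K, x ∉ η.zeros) :
    ∃ ρ > 0, ∀ x ∈ K, ∃ e, η.IsRegularChart e ∧ x ∈ e.source ∧
      Metric.ball (e x) ρ ⊆ e.target := by
  refine hK.induction_on (p := fun K => ∃ ρ > 0, ∀ x ∈ K, ∃ e, η.IsRegularChart e ∧
    x ∈ e.source ∧ Metric.ball (e x) ρ ⊆ e.target) ⟨1, one_pos, by simp⟩ ?_ ?_ ?_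
  · rintro s t hst ⟨ρ, hρ, h⟩
    exact ⟨ρ, hρ, fun x hx => h x (hst hx)⟩
  · rintro s t ⟨ρ, hρ, h⟩ ⟨ρ', hρ', h'⟩
    refine ⟨min ρ ρ', lt_min hρ hρ', fun x hx => ?_⟩
    rcases hx with hx | hx
    · obtain ⟨e, he, hxe, hb⟩ := h x hx
      exact ⟨e, he, hxe, (Metric.ball_subset_ball (min_le_left _ _)).trans hb⟩
    · obtain ⟨e, he, hxe, hb⟩ := h' x hx
      exact ⟨e, he, hxe, (Metric.ball_subset_ball (min_le_right _ _)).trans hb⟩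
  · intro x hx
    obtain ⟨e, he, hxe⟩ := η.exists_isRegularChart (hreg x hx)
    obtain ⟨r, hr, hb⟩ := Metric.isOpen_iff.1 e.open_target _ (e.map_source hxe)
    refine ⟨e.source ∩ e ⁻¹' Metric.ball (e x) (r / 2), mem_nhdsWithin_of_mem_nhds
      ((e.isOpen_inter_preimage Metric.isOpen_ball).mem_nhds
        ⟨hxe, Metric.mem_ball_self (half_pos hr)⟩), r / 2, half_pos hr, ?_⟩
    rintro y ⟨hye, hy⟩
    refine ⟨e, he, hye, (Metric.ball_subset_ball' ?_).trans hb⟩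
    have : dist (e y) (e x) < r / 2 := hy
    linarith

/-- A closed geodesic is contained in a flat strip. -/
theorem exists_flow_box [T2Space X] (hw : w ≠ 0) {g : ℝ → X} (hg : η.IsDeveloped (line w) g univ)
    (hper : Function.Periodic g 1) :
    ∃ ρ > 0, ∃ F : ℂ → X, η.IsDeveloped (scale w) F (strip (Ioo (-ρ) ρ)) ∧
      ∀ t : ℝ, F t = g t := by
  have hK : IsCompact (g '' Icc 0 1) :=
    isCompact_Icc.image_of_continuousOn (hg.continuousOn.mono (subset_univ _))
  have hmem : ∀ t, g t ∈ g '' Icc 0 1 := fun t => by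
    obtain ⟨y, hy, hty⟩ := hper.exists_mem_Ico₀ one_pos t
    exact ⟨y, Ico_subset_Icc_self hy, hty.symm⟩
  obtain ⟨ρ, hρ, h⟩ := exists_uniform_chart (η := η) hK (by
    rintro _ ⟨t, -, rfl⟩
    exact hg.notMem_zeros (mem_univ t))
  choose e he hge hb using fun t => h (g t) (hmem t)
  have hw0 : 0 < ‖w‖ := norm_pos_iff.2 hw
  refine ⟨ρ / ‖w‖, by positivity,
    fun ζ => (e ζ.re).symm (e ζ.re (g ζ.re) + w * (Complex.I * ζ.im)), ?_, fun t => by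
      simp [(e t).left_inv (hge t)]⟩
  refine IsDeveloped.of_local fun ζ₀ hζ₀ => ?_
  set t₀ := ζ₀.re with ht₀
  have hline : ∀ᶠ t in 𝓝 t₀, g t = (e t₀).symm (e t₀ (g t₀) + w * (t - t₀)) := by
    have := hg.eventually_chart (mem_univ t₀) (he t₀).1 (hge t₀)
    rw [nhdsWithin_univ] at this
    filter_upwards [this] with t ht
    have h2 : e t₀ (g t) = e t₀ (g t₀) + w * (t - t₀) := by
      rw [ht.2]
      simp [mul_comm]
    rw [← h2, (e t₀).left_inv ht.1]
  set V : Set ℂ := strip (Ioo (-(ρ / ‖w‖)) (ρ / ‖w‖)) ∩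
    {ζ | ‖ζ - t₀‖ * ‖w‖ < ρ ∧ g ζ.re = (e t₀).symm (e t₀ (g t₀) + w * (ζ.re - t₀))} with hV
  have hζ₀V : ∀ᶠ ζ : ℂ in 𝓝 ζ₀, ‖ζ - t₀‖ * ‖w‖ < ρ ∧
      g ζ.re = (e t₀).symm (e t₀ (g t₀) + w * (ζ.re - t₀)) := by
    refine Filter.Eventually.and ?_ ?_
    · have hc : ContinuousAt (fun ζ : ℂ => ‖ζ - t₀‖ * ‖w‖) ζ₀ := by fun_prop
      refine hc.eventually_lt_const ?_
      have h1 : ζ₀ - t₀ = ζ₀.im * Complex.I := by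
        rw [ht₀]; nth_rewrite 1 [← Complex.re_add_im ζ₀]; ring
      change ‖ζ₀ - t₀‖ * ‖w‖ < ρ
      rw [h1, norm_mul, Complex.norm_I, mul_one, Complex.norm_real, Real.norm_eq_abs,
        ← lt_div_iff₀ hw0, abs_lt]
      exact hζ₀
    · exact Complex.continuous_re.continuousAt.eventually hline
  refine ⟨V, inter_mem self_mem_nhdsWithin (mem_nhdsWithin_of_mem_nhds hζ₀V),
    ⟨hζ₀, hζ₀V.self_of_nhds⟩, ?_⟩
  have hdev : η.IsDeveloped (scale w)
      (fun ζ => (e t₀).symm ((e t₀ (g t₀) - w * t₀) + scale w ζ)) V := by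
    refine ((he t₀).isDeveloped_symm (scale w) _).mono fun ζ hζ => hb t₀ ?_
    rw [mem_ball_iff_norm]
    have h1 : e t₀ (g t₀) - w * t₀ + scale w ζ - e t₀ (g t₀) = (ζ - t₀) * w := by
      change e t₀ (g t₀) - w * t₀ + w * ζ - e t₀ (g t₀) = _
      ring
    rw [h1, norm_mul]
    exact hζ.2.1
  refine hdev.congr fun ζ hζ => ?_
  -- Compare the two charts along the vertical segment from `ζ.re` to `ζ`.
  have hseg : ∀ s ∈ uIcc 0 ζ.im, |s| ≤ |ζ.im| := fun s hs => by
    rw [mem_uIcc] at hs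
    rcases hs with hs | hs
    · rw [abs_of_nonneg hs.1, abs_of_nonneg (hs.1.trans hs.2)]; exact hs.2
    · rw [abs_of_nonpos hs.2, abs_of_nonpos (hs.1.trans hs.2)]; linarith [hs.1]
  have hA : η.IsDeveloped (line (w * Complex.I)) (fun s => (e ζ.re).symm
      (e ζ.re (g ζ.re) + line (w * Complex.I) s)) (uIcc 0 ζ.im) := by
    refine ((he ζ.re).isDeveloped_symm _ _).mono fun s hs => hb ζ.re ?_
    rw [mem_ball_iff_norm, add_sub_cancel_left, ContinuousLinearMap.toSpanSingleton_apply,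
      norm_smul, norm_mul, Complex.norm_I, mul_one, Real.norm_eq_abs, ← lt_div_iff₀ hw0]
    exact (hseg s hs).trans_lt (abs_lt.2 hζ.1)
  have hB : η.IsDeveloped (line (w * Complex.I)) (fun s => (e t₀).symm
      ((e t₀ (g t₀) + w * (ζ.re - t₀)) + line (w * Complex.I) s)) (uIcc 0 ζ.im) := by
    refine ((he t₀).isDeveloped_symm _ _).mono fun s hs => hb t₀ ?_
    have h1 : (e t₀ (g t₀) + w * (ζ.re - t₀)) + line (w * Complex.I) s - e t₀ (g t₀) =
        ((ζ.re - t₀ : ℝ) + s * Complex.I) * w := by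
      rw [ContinuousLinearMap.toSpanSingleton_apply, Complex.real_smul]
      push_cast
      ring
    rw [mem_ball_iff_norm, h1, norm_mul]
    refine lt_of_le_of_lt ?_ hζ.2.1
    gcongr
    rw [Complex.norm_add_mul_I, Complex.norm_eq_sqrt_sq_add_sq]
    apply Real.sqrt_le_sqrt
    have h2 : s ^ 2 ≤ ζ.im ^ 2 := sq_le_sq.2 (hseg s hs)
    simpa using h2
  have := hA.eqOn hB isPreconnected_uIcc left_mem_uIcc (by
    simpa [(e ζ.re).left_inv (hge ζ.re)] using hζ.2.2) right_mem_uIcc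
  simp only [ContinuousLinearMap.toSpanSingleton_apply, Complex.real_smul] at this
  have h3 : w * (Complex.I * ζ.im) = ζ.im * (w * Complex.I) := by ring
  change (e ζ.re).symm (e ζ.re (g ζ.re) + w * (Complex.I * ζ.im)) = _
  rw [h3, this]
  congr 1
  change _ = e t₀ (g t₀) - w * t₀ + w * ζ
  nth_rewrite 3 [← Complex.re_add_im ζ]
  ring

end AbelianDifferential

end Strips

/-! ### Cylinders are images of flat strips -/

section CylinderStructure

namespace ClosedCurve

variable {X : Type*} [TopologicalSpace X]

theorem homotopic_iff (σ τ : ClosedCurve X) : σ.Homotopic τ ↔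
    ContinuousMap.HomotopicWith ⟨σ.toFun, σ.continuous⟩ ⟨τ.toFun, τ.continuous⟩
      (fun f : C(ℝ, X) => Function.Periodic f 1) := by
  constructor
  · rintro ⟨H, hH, h0, h1, hp⟩
    exact ⟨{ toFun := H, continuous_toFun := hH, map_zero_left := h0, map_one_left := h1,
             prop' := fun s t => hp s t }⟩
  · rintro ⟨H⟩
    exact ⟨H, H.continuous, fun t => H.apply_zero t, fun t => H.apply_one t,
      fun s t => H.prop s t⟩

theorem Homotopic.symm {σ τ : ClosedCurve X} (h : σ.Homotopic τ) : τ.Homotopic σ := by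
  rw [homotopic_iff] at h ⊢
  exact h.symm

theorem Homotopic.trans {σ τ υ : ClosedCurve X} (h : σ.Homotopic τ) (h' : τ.Homotopic υ) :
    σ.Homotopic υ := by
  rw [homotopic_iff] at h h' ⊢
  exact h.trans h'

/-- Changing the initial point of a closed curve does not change its free homotopy class. -/
theorem Homotopic.of_shift {σ τ : ClosedCurve X} (a : ℝ)
    (h : ∀ t, τ.toFun t = σ.toFun (t + a)) : σ.Homotopic τ := by
  refine ⟨fun q => σ.toFun (q.2 + q.1 * a), σ.continuous.comp (by fun_prop), fun t => by simp,
    fun t => by simp [h], fun s t => ?_⟩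
  change σ.toFun (t + 1 + s * a) = σ.toFun (t + s * a)
  rw [← σ.periodic (t + s * a)]
  congr 1
  ring

end ClosedCurve

namespace AbelianDifferential

variable {X : Type*} [TopologicalSpace X] [ChartedSpace ℂ X]
  {η : AbelianDifferential X} {w : ℂ} {F G : ℂ → X} {I J : Set ℝ}

theorem IsDeveloped.piecewise {S T : Set ℂ} (hF : η.IsDeveloped (scale w) F S)
    (hG : η.IsDeveloped (scale w) G T) (hS : IsOpen S) (hT : IsOpen T) (h : EqOn F G (S ∩ T))
    [∀ z, Decidable (z ∈ S)] : η.IsDeveloped (scale w) (S.piecewise F G) (S ∪ T) := by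
  refine IsDeveloped.of_local fun z hz => ?_
  rcases hz with hz | hz
  · exact ⟨S, mem_nhdsWithin_of_mem_nhds (hS.mem_nhds hz), hz,
      hF.congr fun y hy => piecewise_eq_of_mem _ _ _ hy⟩
  · refine ⟨T, mem_nhdsWithin_of_mem_nhds (hT.mem_nhds hz), hz, hG.congr fun y hy => ?_⟩
    by_cases hyS : y ∈ S
    · rw [piecewise_eq_of_mem _ _ _ hyS, h ⟨hyS, hy⟩]
    · rw [piecewise_eq_of_notMem _ _ _ hyS]

/-- Translates of developed maps are developed. -/
theorem IsDeveloped.comp_add_right {S : Set ℂ} (hF : η.IsDeveloped (scale w) F S) (a : ℂ) :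
    η.IsDeveloped (scale w) (fun z => F (z + a)) {z | z + a ∈ S} :=
  hF.comp (φ := fun z => z + a) (by fun_prop) (fun z hz => hz) fun z _ z' _ => by simp

theorem IsDeveloped.horizontal (hF : η.IsDeveloped (scale w) F (strip I)) {s : ℝ} (hs : s ∈ I)
    (a : ℝ) : η.IsDeveloped (line w) (fun t : ℝ => F (t + a + s * Complex.I)) univ :=
  hF.comp (φ := fun t : ℝ => (t + a + s * Complex.I : ℂ)) (by fun_prop)
    (fun t _ => by simpa [strip] using hs) fun z _ z' _ => by
      simp only [ContinuousLinearMap.toSpanSingleton_apply, Complex.real_smul,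
        ContinuousLinearMap.mul_apply']
      push_cast
      ring

variable [IsManifold 𝓘(ℂ, ℂ) ω X]

theorem _root_.TranslationSurface.ClosedGeodesic.isDeveloped (g : ClosedGeodesic η w) :
    η.IsDeveloped (line w) g.toFun univ :=
  isDeveloped_of_isMIntegralCurveOn convex_univ (g.geodesic.isMIntegralCurveOn _)
    fun t _ => g.regular t

variable [T2Space X]

/-- If a developed map on a strip takes the same value at two points on the same horizontal line,
it is periodic on the whole strip. -/
theorem IsDeveloped.periodic_of_eq (hF : η.IsDeveloped (scale w) F (strip I))
    (hI : I.OrdConnected) {z : ℂ} (hz : z ∈ strip I) {a : ℝ} (h : F (z + a) = F z) :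
    ∀ ζ ∈ strip I, F (ζ + a) = F ζ := by
  have h1 : η.IsDeveloped (scale w) (fun ζ => F (ζ + a)) (strip I) :=
    (hF.comp_add_right a).mono fun ζ hζ => by simpa [strip] using hζ
  exact h1.eqOn hF (isPreconnected_strip hI) hz h

/-- Two closed geodesics with the same displacement vector and a common point are the same up to
the choice of the initial point. -/
theorem _root_.TranslationSurface.ClosedGeodesic.eq_shift (g g' : ClosedGeodesic η w) {a b : ℝ}
    (h : g.toFun a = g'.toFun b) (t : ℝ) : g'.toFun t = g.toFun (t + (a - b)) := by
  have h1 : η.IsDeveloped (line w) (fun t => g.toFun (t + (a - b))) univ :=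
    g.isDeveloped.comp (φ := fun t => t + (a - b)) (by fun_prop) (fun _ _ => mem_univ _)
      fun z _ z' _ => by simp
  exact g'.isDeveloped.eqOn h1 isPreconnected_univ (mem_univ b) (by simp [h]) (mem_univ t)

theorem _root_.TranslationSurface.ClosedGeodesic.homotopic_of_eq (g g' : ClosedGeodesic η w)
    {a b : ℝ} (h : g.toFun a = g'.toFun b) : g.toClosedCurve.Homotopic g'.toClosedCurve :=
  ClosedCurve.Homotopic.of_shift (a - b) (g.eq_shift g' h)

/-- A horizontal line of a strip that contains a simple closed geodesic is itself a simple closed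
geodesic. -/
def horizontalGeodesic (hw : w ≠ 0) (hF : η.IsDeveloped (scale w) F (strip I))
    (hI : I.OrdConnected) (h0 : 0 ∈ I) (g : ClosedGeodesic η w) (hg : ∀ t : ℝ, F t = g.toFun t)
    {s : ℝ} (hs : s ∈ I) : ClosedGeodesic η w where
  toFun t := F (t + s * Complex.I)
  continuous := by
    have := (hF.horizontal hs 0).continuousOn
    simpa [continuousOn_univ] using this
  periodic t := by
    have h1 := hF.periodic_of_eq hI (z := 0) (by simpa [strip] using h0) (a := 1)
      (by
        have h2 := hg 0
        have h3 := hg 1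
        have h4 := g.periodic 0
        rw [zero_add] at h4 ⊢
        rw [h3, h4, ← h2, Complex.ofReal_zero])
    have := h1 (t + s * Complex.I) (by simpa [strip] using hs)
    change F ((t + 1 : ℝ) + s * Complex.I) = F (t + s * Complex.I)
    rw [← this]
    congr 1
    push_cast
    ring
  displacement_ne_zero := hw
  regular t := hF.notMem_zeros (by simpa [strip] using hs)
  geodesic := by
    have := (hF.horizontal hs 0).isMIntegralCurveOn
    rw [isMIntegralCurve_iff_isMIntegralCurveOn]
    simpa using this
  simple := by
    -- A coincidence on one line would give a period of the strip, hence of `g`.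
    have key : ∀ t ∈ Ico (0 : ℝ) 1, ∀ t' ∈ Ico (0 : ℝ) 1, F (t + s * Complex.I) =
        F (t' + s * Complex.I) → t = t' := fun t ht t' ht' h => by
      wlog hlt : t < t' generalizing t t'
      · rcases eq_or_lt_of_le (not_lt.1 hlt) with h1 | h1
        · exact h1.symm
        · exact (this t' ht' t ht h.symm h1).symm
      have h1 := hF.periodic_of_eq hI (z := t + s * Complex.I) (by simpa [strip] using hs)
        (a := t' - t) (by rw [h]; congr 1; push_cast; ring)
      have h2 := h1 0 (by simpa [strip] using h0)
      have h3 := hg 0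
      rw [zero_add, hg, ← Complex.ofReal_zero, hg] at h2
      have := g.simple (x₁ := t' - t) ⟨by linarith, by linarith [ht.1, ht'.2]⟩
        (x₂ := 0) ⟨le_rfl, one_pos⟩ h2
      linarith
    exact fun t ht t' ht' h => key t ht t' ht' h

/-- `J` is an open interval around `0` that carries a developed map based at `x₀`. -/
def IsStripInterval (η : AbelianDifferential X) (w : ℂ) (x₀ : X) (J : Set ℝ) : Prop :=
  IsOpen J ∧ J.OrdConnected ∧ 0 ∈ J ∧ ∃ F : ℂ → X, F 0 = x₀ ∧ η.IsDeveloped (scale w) F (strip J)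

/-- By uniqueness of developed maps the strips around `x₀` fit together to a greatest one. -/
theorem exists_greatest_strip {x₀ : X} {J₀ : Set ℝ} (hJ₀ : η.IsStripInterval w x₀ J₀) :
    ∃ I, IsGreatest {J | η.IsStripInterval w x₀ J} I := by
  classical
  have : Nonempty X := ⟨x₀⟩
  set 𝒥 := {J | η.IsStripInterval w x₀ J} with h𝒥
  refine ⟨⋃₀ 𝒥, ⟨isOpen_sUnion fun J hJ => hJ.1, ?_, mem_sUnion_of_mem hJ₀.2.2.1 hJ₀, ?_⟩,
    fun J hJ => subset_sUnion_of_mem hJ⟩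
  · exact (isPreconnected_sUnion 0 𝒥 (fun J hJ => hJ.2.2.1)
      fun J hJ => hJ.2.1.isPreconnected).ordConnected
  · have hc : ∀ ζ ∈ strip (⋃₀ 𝒥), ∃ J ∈ 𝒥, ζ ∈ strip J := fun ζ hζ => hζ
    choose! J hJ hζJ using hc
    have hc2 : ∀ J ∈ 𝒥, ∃ F : ℂ → X, F 0 = x₀ ∧ η.IsDeveloped (scale w) F (strip J) :=
      fun J hJ => hJ.2.2.2
    choose! G hG0 hG using hc2
    have heq : ∀ K ∈ 𝒥, EqOn (fun ζ => G (J ζ) ζ) (G K) (strip K) := fun K hK ζ hζ => by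
      have hζ' : ζ ∈ strip (⋃₀ 𝒥) := mem_sUnion_of_mem hζ hK
      have hJζ := hJ ζ hζ'
      have hoc : (J ζ ∩ K).OrdConnected := hJζ.2.1.inter hK.2.1
      exact ((hG _ hJζ).mono (T := strip (J ζ ∩ K)) fun z hz => hz.1).eqOn
        ((hG _ hK).mono fun z hz => hz.2) (isPreconnected_strip hoc) (z₀ := 0)
        ⟨hJζ.2.2.1, hK.2.2.1⟩ ((hG0 _ hJζ).trans (hG0 _ hK).symm) ⟨hζJ ζ hζ', hζ⟩
    refine ⟨fun ζ => G (J ζ) ζ, ?_, IsDeveloped.of_local fun ζ hζ => ?_⟩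
    · exact hG0 _ (hJ 0 (mem_sUnion_of_mem hJ₀.2.2.1 hJ₀))
    · exact ⟨strip (J ζ), mem_nhdsWithin_of_mem_nhds
        ((isOpen_strip (hJ ζ hζ).1).mem_nhds (hζJ ζ hζ)), hζJ ζ hζ,
        (hG _ (hJ ζ hζ)).congr (heq _ (hJ ζ hζ))⟩

/-- A strip that meets the greatest strip around `x₀` continues it, so it is contained in it. -/
theorem image_subset_of_inter_nonempty {x₀ : X} (hI : IsGreatest {J | η.IsStripInterval w x₀ J} I)
    (hF0 : F 0 = x₀) (hF : η.IsDeveloped (scale w) F (strip I)) (hJo : IsOpen J)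
    (hJ : J.OrdConnected) (hG : η.IsDeveloped (scale w) G (strip J))
    (hne : (F '' strip I ∩ G '' strip J).Nonempty) : G '' strip J ⊆ F '' strip I := by
  classical
  obtain ⟨_, ⟨a, ha, rfl⟩, b, hb, hab⟩ := hne
  -- After translation by `c` the two strips overlap at `a`.
  set c := b - a with hc
  set J' : Set ℝ := {s | s + c.im ∈ J} with hJ'
  have hJ'o : IsOpen J' := hJo.preimage (by fun_prop)
  have hJ'c : J'.OrdConnected :=
    ⟨fun x hx y hy z hz => hJ.out hx hy ⟨by linarith [hz.1], by linarith [hz.2]⟩⟩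
  have hG' : η.IsDeveloped (scale w) (fun z => G (z + c)) (strip J') :=
    (hG.comp_add_right c).mono fun z hz => by simpa [strip, hJ'] using hz
  have haJ' : a ∈ strip J' := by
    have : a + c = b := by rw [hc]; ring
    change a.im + c.im ∈ J
    rw [← Complex.add_im, this]
    exact hb
  have hIo := hI.1.1
  have hIc := hI.1.2.1
  have heq : EqOn F (fun z => G (z + c)) (strip I ∩ strip J') := by
    refine (hF.mono inter_subset_left).eqOn (hG'.mono inter_subset_right)
      (isPreconnected_strip (hIc.inter hJ'c)) (z₀ := a) ⟨ha, haJ'⟩ ?_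
    simp [hc, hab]
  have hU : η.IsStripInterval w x₀ (I ∪ J') := by
    refine ⟨hIo.union hJ'o, ?_, Or.inl hI.1.2.2.1, _, ?_,
      hF.piecewise hG' (isOpen_strip hIo) (isOpen_strip hJ'o) heq⟩
    · exact (IsPreconnected.union a.im ha haJ' hIc.isPreconnected hJ'c.isPreconnected).ordConnected
    · rw [piecewise_eq_of_mem _ _ _ (by exact hI.1.2.2.1), hF0]
  have hsub : J' ⊆ I := subset_union_right.trans (hI.2 hU)
  rintro _ ⟨z, hz, rfl⟩
  have hz' : z - c ∈ strip J' := by simpa [strip, hJ'] using hz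
  refine ⟨z - c, hsub hz', ?_⟩
  rw [heq ⟨hsub hz', hz'⟩]
  simp

/-- A cylinder is the image of a flat strip, under a developed map of period `1`. -/
theorem _root_.TranslationSurface.IsCylinder.exists_strip {C : Set X} (hC : IsCylinder η w C) :
    w ≠ 0 ∧ ∃ (I : Set ℝ) (F : ℂ → X), IsOpen I ∧ I.OrdConnected ∧
      η.IsDeveloped (scale w) F (strip I) ∧ (∀ z ∈ strip I, F (z + 1) = F z) ∧
      C = F '' strip I := by
  obtain ⟨hconn, 𝒢, rfl, hhom⟩ := hC.prop
  obtain ⟨x, hx⟩ := hconn.nonempty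
  simp only [mem_iUnion] at hx
  obtain ⟨g, hg, a, rfl⟩ := hx
  have hw := g.displacement_ne_zero
  obtain ⟨ρ, hρ, F₀, hF₀, hF₀g⟩ := exists_flow_box hw g.isDeveloped g.periodic
  obtain ⟨I, hI⟩ := exists_greatest_strip (η := η) (w := w) (x₀ := g.toFun 0)
    (J₀ := Ioo (-ρ) ρ) ⟨isOpen_Ioo, ordConnected_Ioo, by simp [hρ], F₀, by simpa using hF₀g 0, hF₀⟩
  obtain ⟨hIo, hIc, h0I, F, hF0, hF⟩ := hI.1
  have hFg : ∀ t : ℝ, F t = g.toFun t := fun t => by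
    have := (hF.horizontal h0I 0).eqOn g.isDeveloped isPreconnected_univ (mem_univ 0)
      (by simpa using hF0) (mem_univ t)
    simpa using this
  set γ := fun (s : ℝ) (hs : s ∈ I) => horizontalGeodesic hw hF hIc h0I g hFg hs with hγ
  have hγF : ∀ s hs t, (γ s hs).toFun t = F (t + s * Complex.I) := fun s hs t => rfl
  have hper : ∀ z ∈ strip I, F (z + 1) = F z := fun z hz => by
    have hz' : z.im ∈ I := hz
    have := (γ z.im hz').periodic z.re
    rw [hγF, hγF, Complex.re_add_im] at this
    rw [← this]
    congr 1
    nth_rewrite 1 [← Complex.re_add_im z]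
    push_cast
    ring
  have hgz : g.toFun 0 ∈ F '' strip I := ⟨0, by simpa [strip] using h0I, by simpa using hFg 0⟩
  have hγhom : ∀ s hs, g.toClosedCurve.Homotopic (γ s hs).toClosedCurve := fun s hs => by
    have hm : ∀ q : unitInterval × ℝ, (q.2 + (q.1 * s : ℝ) * Complex.I : ℂ) ∈ strip I := fun q => by
      have h1 := hIc.convex.smul_mem_of_zero_mem h0I hs q.1.2
      simpa [strip] using h1
    refine ⟨fun q => F (q.2 + (q.1 * s : ℝ) * Complex.I), ?_, fun t => ?_, fun t => ?_,
      fun σ t => ?_⟩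
    · exact hF.continuousOn.comp_continuous (by fun_prop) hm
    · simp [hFg]
    · simp [hγF]
    · have := hper _ (hm (σ, t))
      change F ((t + 1 : ℝ) + (σ * s : ℝ) * Complex.I) = F (t + (σ * s : ℝ) * Complex.I)
      rw [← this]
      congr 1
      push_cast
      ring
  refine ⟨hw, I, F, hIo, hIc, hF, hper, subset_antisymm ?_ ?_⟩
  · -- The image of the strip is open and relatively closed in the cylinder.
    refine hconn.isPreconnected.subset_of_closure_inter_subset
      (hF.isOpen_image hw (isOpen_strip hIo)) ⟨g.toFun 0, mem_biUnion hg ⟨0, rfl⟩, hgz⟩ ?_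
    rintro y ⟨hyc, hy⟩
    simp only [mem_iUnion] at hy
    obtain ⟨g', hg', b, rfl⟩ := hy
    obtain ⟨ρ', hρ', G, hG, hGg⟩ := exists_flow_box hw g'.isDeveloped g'.periodic
    have hbG : g'.toFun b ∈ G '' strip (Ioo (-ρ') ρ') :=
      ⟨b, by simp [strip, hρ'], hGg b⟩
    refine image_subset_of_inter_nonempty hI hF0 hF isOpen_Ioo ordConnected_Ioo hG ?_ hbG
    obtain ⟨x, h1, h2⟩ := mem_closure_iff.1 hyc _ (hG.isOpen_image hw (isOpen_strip isOpen_Ioo)) hbG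
    exact ⟨x, h2, h1⟩
  · -- Adding the horizontal lines of the strip to the cylinder does not enlarge it.
    set 𝒢' := 𝒢 ∪ {h | ∃ s hs, h = γ s hs} with h𝒢'
    have hunion : (⋃ g ∈ 𝒢, range g.toFun) ∪ F '' strip I = ⋃ g ∈ 𝒢', range g.toFun := by
      rw [h𝒢', biUnion_union]
      congr 1
      ext x
      simp only [mem_iUnion, mem_image, mem_ofPred_eq]
      constructor
      · rintro ⟨z, hz, rfl⟩
        have hz' : z.im ∈ I := hz
        exact ⟨γ z.im hz', ⟨z.im, hz', rfl⟩, z.re, by rw [hγF, Complex.re_add_im]⟩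
      · rintro ⟨_, ⟨s, hs, rfl⟩, t, rfl⟩
        exact ⟨t + s * Complex.I, by simpa [strip] using hs, rfl⟩
    have hall : ∀ h ∈ 𝒢', g.toClosedCurve.Homotopic h.toClosedCurve := by
      rintro h (hh | ⟨s, hs, rfl⟩)
      · exact hhom g hg h hh
      · exact hγhom s hs
    have hle := hC.le_of_ge (y := (⋃ g ∈ 𝒢, range g.toFun) ∪ F '' strip I)
      ⟨hconn.union ⟨g.toFun 0, mem_biUnion hg ⟨0, rfl⟩, hgz⟩
        ⟨⟨_, hgz⟩, (isPreconnected_strip hIc).image _ hF.continuousOn⟩, 𝒢', hunion,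
        fun h hh h' hh' => (hall h hh).symm.trans (hall h' hh')⟩ subset_union_left
    exact subset_union_right.trans hle

/-- Cylinders with the same displacement vector are disjoint or equal. -/
theorem _root_.TranslationSurface.IsCylinder.eq_of_mem {C C' : Set X} (hC : IsCylinder η w C)
    (hC' : IsCylinder η w C') {x : X} (hx : x ∈ C) (hx' : x ∈ C') : C = C' := by
  obtain ⟨hconn, 𝒢, h𝒢, hhom⟩ := hC.prop
  obtain ⟨hconn', 𝒢', h𝒢', hhom'⟩ := hC'.prop
  have hx1 := hx
  have hx1' := hx'
  rw [h𝒢] at hx1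
  rw [h𝒢'] at hx1'
  simp only [mem_iUnion] at hx1 hx1'
  obtain ⟨g, hg, a, rfl⟩ := hx1
  obtain ⟨g', hg', b, hab⟩ := hx1'
  have hgg' : g.toClosedCurve.Homotopic g'.toClosedCurve := g.homotopic_of_eq g' hab.symm
  have hall : ∀ h ∈ 𝒢 ∪ 𝒢', g.toClosedCurve.Homotopic h.toClosedCurve := by
    rintro h (hh | hh)
    · exact hhom g hg h hh
    · exact hgg'.trans (hhom' g' hg' h hh)
  have hP : IsConnected (C ∪ C') ∧ ∃ 𝒢 : Set (ClosedGeodesic η w), C ∪ C' = ⋃ g ∈ 𝒢, range g.toFun ∧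
      ∀ g ∈ 𝒢, ∀ g' ∈ 𝒢, g.toClosedCurve.Homotopic g'.toClosedCurve :=
    ⟨hconn.union ⟨_, hx, hx'⟩ hconn', 𝒢 ∪ 𝒢', by rw [biUnion_union, h𝒢, h𝒢'],
      fun h hh h' hh' => (hall h hh).symm.trans (hall h' hh')⟩
  exact subset_antisymm (subset_union_left.trans (hC'.le_of_ge hP subset_union_right))
    (subset_union_right.trans (hC.le_of_ge hP subset_union_left))

end AbelianDifferential

end CylinderStructure

/-! ### Long cylinders -/

section LongCylinders

theorem volume_setOf_add_notMem_le {I : Set ℝ} (hI : I.OrdConnected) (δ : ℝ) :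
    volume {s | s ∈ I ∧ s + δ ∉ I} ≤ ENNReal.ofReal |δ| := by
  refine (Real.volume_le_diam _).trans (Metric.ediam_le fun s hs t ht => ?_)
  rw [edist_dist, Real.dist_eq]
  refine ENNReal.ofReal_le_ofReal ?_
  -- Two points at a distance more than `|δ|` cannot both leave `I` under the shift by `δ`.
  have key : ∀ s t, s ∈ I → s + δ ∉ I → t ∈ I → t + δ ∉ I → s ≤ t → t - s ≤ |δ| := by
    intro s t hs hs' ht ht' hst
    by_contra! h
    rcases le_total 0 δ with hδ | hδ
    · rw [abs_of_nonneg hδ] at h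
      exact hs' (hI.out hs ht ⟨by linarith, by linarith⟩)
    · rw [abs_of_nonpos hδ] at h
      exact ht' (hI.out hs ht ⟨by linarith, by linarith⟩)
  rcases le_total s t with h | h
  · rw [abs_sub_comm, abs_of_nonneg (sub_nonneg.2 h)]
    exact key s t hs.1 hs.2 ht.1 ht.2 h
  · rw [abs_of_nonneg (sub_nonneg.2 h)]
    exact key t s ht.1 ht.2 hs.1 hs.2 h

theorem volume_reProdIm {s t : Set ℝ} (hs : MeasurableSet s) (ht : MeasurableSet t) :
    volume (s ×ℂ t) = volume s * volume t := by
  have h : s ×ℂ t = Complex.measurableEquivRealProd ⁻¹' (s ×ˢ t) := rfl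
  rw [h, Complex.volume_preserving_equiv_real_prod.measure_preimage
    (hs.prod ht).nullMeasurableSet, Measure.volume_eq_prod, Measure.prod_prod]

/-- Infinitely many sets of measure bounded below have a point in common. -/
theorem exists_frequently_mem {α : Type*} [MeasurableSpace α] {μ : Measure α} [IsFiniteMeasure μ]
    {K : ℕ → Set α} (hK : ∀ n, MeasurableSet (K n)) {c : ENNReal} (hc : 0 < c)
    (h : ∀ n, c ≤ μ (K n)) : ∃ x, ∃ᶠ n in atTop, x ∈ K n := by
  have h1 : c ≤ μ (⋂ m, ⋃ n ≥ m, K n) := by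
    have hanti : Antitone fun m => ⋃ n ≥ m, K n := fun m m' hm =>
      biUnion_subset_biUnion_left fun n hn => le_trans hm hn
    refine ge_of_tendsto (tendsto_measure_iInter_atTop (μ := μ) (fun m =>
      (MeasurableSet.iUnion fun n => MeasurableSet.iUnion fun _ => hK n).nullMeasurableSet)
      hanti ⟨0, measure_ne_top _ _⟩) (Eventually.of_forall fun m => (h m).trans ?_)
    exact measure_mono (subset_biUnion_of_mem (u := K) (le_refl m))
  obtain ⟨x, hx⟩ := nonempty_of_measure_ne_zero (hc.trans_le h1).ne'
  refine ⟨x, frequently_atTop.2 fun m => ?_⟩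
  simpa using mem_iInter.1 hx m

variable {X : Type*} [TopologicalSpace X] [ChartedSpace ℂ X] [IsManifold 𝓘(ℂ, ℂ) ω X]
  [MeasurableSpace X] [BorelSpace X]
  {η : AbelianDifferential X} {w : ℂ} {F : ℂ → X} {I : Set ℝ}

namespace AbelianDifferential

/-- The part of a cylinder that leaves it under a transverse displacement by `δ` is small. -/
theorem IsDeveloped.area_image_add_notMem_le [SecondCountableTopology X]
    (hF : η.IsDeveloped (scale w) F (strip I)) (hw : w ≠ 0) (hIo : IsOpen I)
    (hI : I.OrdConnected) (hper : ∀ z ∈ strip I, F (z + 1) = F z) (δ : ℝ) :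
    η.area (F '' {z | z.im ∈ I ∧ z.im + δ ∉ I}) ≤ ENNReal.ofReal (‖w‖ ^ 2 * |δ|) := by
  set T := {s | s ∈ I ∧ s + δ ∉ I} with hT
  have hTm : MeasurableSet T :=
    hIo.measurableSet.inter ((hIo.preimage (f := fun s => s + δ) (by fun_prop)).measurableSet.compl)
  -- By periodicity a fundamental domain of width `1` suffices.
  have hsub : F '' {z | z.im ∈ I ∧ z.im + δ ∉ I} ⊆ F '' (Ico 0 1 ×ℂ T) := by
    rintro _ ⟨z, hz, rfl⟩
    have hp : Function.Periodic (fun t : ℝ => F (t + z.im * Complex.I)) 1 := fun t => by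
      have := hper (t + z.im * Complex.I) (by simpa [strip] using hz.1)
      change F ((t + 1 : ℝ) + z.im * Complex.I) = F (t + z.im * Complex.I)
      rw [← this]
      congr 1
      push_cast
      ring
    obtain ⟨t, ht, h⟩ := hp.exists_mem_Ico₀ one_pos z.re
    refine ⟨t + z.im * Complex.I, ?_, ?_⟩
    · rw [Complex.mem_reProdIm]
      simpa [hT] using ⟨ht, hz⟩
    · simpa using h.symm
  refine (measure_mono hsub).trans ((hF.area_image_le hw (isOpen_strip hIo) ?_ ?_).trans ?_)
  · exact (measurableSet_Ico.preimage Complex.measurable_re).inter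
      (hTm.preimage Complex.measurable_im)
  · rintro z hz
    exact hz.2.1
  · rw [volume_reProdIm measurableSet_Ico hTm, Real.volume_Ico, ENNReal.ofReal_mul (by positivity)]
    gcongr
    simpa using volume_setOf_add_notMem_le hI δ

variable [T2Space X] [CompactSpace X]

/-- A compact translation surface has only finitely many cylinders of bounded circumference and of
area bounded below. Infinitely many would have a common point deep inside; two of them with
displacement vectors close together would, in the flat neighbourhood of that point, return to
different points. -/
theorem finite_short_cylinders (η : AbelianDifferential X) {ε : ℝ} (hε : 0 < ε) (L : ℝ) :
    {C | ∃ w, IsCylinder η w C ∧ ENNReal.ofReal ε < η.area C ∧ ‖w‖ ≤ L}.Finite := by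
  by_contra hinf
  have : SecondCountableTopology X := ChartedSpace.secondCountable_of_sigmaCompact ℂ X
  have : IsFiniteMeasure η.area := ⟨η.area_lt_top⟩
  set C : ℕ → Set X := fun n => ((Set.Infinite.natEmbedding _ hinf) n : Set X) with hC
  have hCinj : Function.Injective C :=
    Subtype.val_injective.comp (Set.Infinite.natEmbedding _ hinf).injective
  have hCP : ∀ n, ∃ w, IsCylinder η w (C n) ∧ ENNReal.ofReal ε < η.area (C n) ∧ ‖w‖ ≤ L :=
    fun n => ((Set.Infinite.natEmbedding _ hinf) n).2
  choose w hcyl harea hwL using hCP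
  choose hw I F hIo hI hF hper hCF using fun n => (hcyl n).exists_strip
  have hw0 : ∀ n, 0 < ‖w n‖ := fun n => norm_pos_iff.2 (hw n)
  have hL : 0 < L := (hw0 0).trans_le (hwL 0)
  set r := ε / (4 * L) with hr
  have hr0 : 0 < r := by positivity
  set S : ℕ → Set ℂ := fun n => strip (I n) ∩
    {z | z.im + r / ‖w n‖ ∈ I n ∧ z.im - r / ‖w n‖ ∈ I n} with hS
  have hSo : ∀ n, IsOpen (S n) := fun n =>
    (isOpen_strip (hIo n)).inter (((hIo n).preimage (by fun_prop)).inter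
      ((hIo n).preimage (by fun_prop)))
  set K : ℕ → Set X := fun n => F n '' S n with hK
  have hKo : ∀ n, IsOpen (K n) := fun n =>
    ((hF n).mono inter_subset_left).isOpen_image (hw n) (hSo n)
  have hKarea : ∀ n, ENNReal.ofReal (ε / 2) ≤ η.area (K n) := fun n => by
    have hcov : C n ⊆ K n ∪ (F n '' {z | z.im ∈ I n ∧ z.im + r / ‖w n‖ ∉ I n} ∪
        F n '' {z | z.im ∈ I n ∧ z.im + -(r / ‖w n‖) ∉ I n}) := by
      rw [hCF n, ← image_union, ← image_union]
      refine image_mono fun z hz => ?_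
      have hz' : z.im ∈ I n := hz
      by_cases h1 : z.im + r / ‖w n‖ ∈ I n
      · by_cases h2 : z.im + -(r / ‖w n‖) ∈ I n
        · exact Or.inl ⟨hz, h1, by rwa [← sub_eq_add_neg] at h2⟩
        · exact Or.inr (Or.inr ⟨hz', h2⟩)
      · exact Or.inr (Or.inl ⟨hz', h1⟩)
    have hb : ‖w n‖ ^ 2 * (r / ‖w n‖) ≤ ε / 4 := by
      have h1 : ‖w n‖ ^ 2 * (r / ‖w n‖) = ‖w n‖ * r := by
        have := (hw0 n).ne'
        field_simp
      have h2 : L * r = ε / 4 := by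
        rw [hr]
        field_simp
      rw [h1, ← h2]
      exact mul_le_mul_of_nonneg_right (hwL n) hr0.le
    have hpos : 0 ≤ r / ‖w n‖ := by have := hw0 n; positivity
    have h1 := (hF n).area_image_add_notMem_le (hw n) (hIo n) (hI n) (hper n) (r / ‖w n‖)
    have h2 := (hF n).area_image_add_notMem_le (hw n) (hIo n) (hI n) (hper n) (-(r / ‖w n‖))
    rw [abs_neg] at h2
    rw [abs_of_nonneg hpos] at h1 h2
    have h3 := h1.trans (ENNReal.ofReal_le_ofReal hb)
    have h4 := h2.trans (ENNReal.ofReal_le_ofReal hb)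
    have h5 : ENNReal.ofReal ε ≤ η.area (K n) + ENNReal.ofReal (ε / 2) :=
      calc ENNReal.ofReal ε ≤ η.area (C n) := (harea n).le
        _ ≤ _ := (measure_mono hcov).trans (measure_union_le _ _)
        _ ≤ η.area (K n) + (ENNReal.ofReal (ε / 4) + ENNReal.ofReal (ε / 4)) := by
          gcongr
          exact (measure_union_le _ _).trans (add_le_add h3 h4)
        _ = η.area (K n) + ENNReal.ofReal (ε / 2) := by
          rw [← ENNReal.ofReal_add (by positivity) (by positivity)]
          congr 2
          ring
    have h6 : ENNReal.ofReal ε = ENNReal.ofReal (ε / 2) + ENNReal.ofReal (ε / 2) := by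
      rw [← ENNReal.ofReal_add (by positivity) (by positivity), add_halves]
    rw [h6] at h5
    exact (ENNReal.add_le_add_iff_right ENNReal.ofReal_ne_top).1 h5
  obtain ⟨w₀, -, φ, hφ, hlim⟩ := (isCompact_closedBall (0 : ℂ) L).tendsto_subseq
    (fun n => mem_closedBall_zero_iff.2 (hwL n))
  obtain ⟨x, hx⟩ := exists_frequently_mem (μ := η.area) (K := K ∘ φ)
    (fun n => (hKo _).measurableSet) (ENNReal.ofReal_pos.2 (half_pos hε)) fun n => hKarea _
  obtain ⟨n₀, z₀, hz₀, hxz₀⟩ := hx.exists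
  have hreg : x ∉ η.zeros := by
    rw [← hxz₀]
    exact (hF _).notMem_zeros hz₀.1
  obtain ⟨e, he, hxe⟩ := η.exists_isRegularChart hreg
  obtain ⟨ρ, hρ, hb⟩ := Metric.isOpen_iff.1 e.open_target _ (e.map_source hxe)
  have hev : ∀ᶠ n in atTop, dist (w (φ n)) w₀ < min r ρ / 2 :=
    hlim (Metric.ball_mem_nhds _ (by positivity))
  obtain ⟨n, hxn, hn⟩ := (hx.and_eventually hev).exists
  obtain ⟨m, hxm, hm, hnm⟩ := (hx.and_eventually (hev.and (eventually_gt_atTop n))).exists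
  have hwnm : ‖w (φ m) - w (φ n)‖ < min r ρ := by
    rw [← dist_eq_norm]
    linarith [dist_triangle_right (w (φ m)) (w (φ n)) w₀]
  generalize hn' : φ n = n' at *
  generalize hm' : φ m = m' at *
  have hne : C n' ≠ C m' := fun h => by
    have := hφ.injective (hn'.trans ((hCinj h).trans hm'.symm))
    omega
  obtain ⟨z, hz, hzx⟩ : x ∈ K n' := by simpa [hn'] using hxn
  obtain ⟨z', hz', hzx'⟩ : x ∈ K m' := by simpa [hm'] using hxm
  have hzs : z ∈ strip (I n') := hz.1
  set q := w m' / w n' with hq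
  have hqw : w n' * q = w m' := mul_div_cancel₀ _ (hw n')
  have hqim : |q.im| ≤ r / ‖w n'‖ := by
    have h1 : q.im = ((w m' - w n') / w n').im := by
      rw [sub_div, div_self (hw n'), Complex.sub_im, Complex.one_im, sub_zero]
    rw [h1]
    refine (Complex.abs_im_le_norm _).trans ?_
    rw [norm_div]
    gcongr
    exact (hwnm.trans_le (min_le_left _ _)).le
  have hmem : ∀ σ ∈ Icc (0 : ℝ) 1, ∀ a : ℝ, (z + σ * (q - a) : ℂ) ∈ strip (I n') := by
    intro σ hσ a
    have h1 : (z + σ * (q - a) : ℂ).im = z.im + σ * q.im := by simp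
    change (z + σ * (q - a) : ℂ).im ∈ I n'
    have h2 : |σ * q.im| ≤ r / ‖w n'‖ := by
      rw [abs_mul, abs_of_nonneg hσ.1]
      exact (mul_le_of_le_one_left (abs_nonneg _) hσ.2).trans hqim
    rw [abs_le] at h2
    rw [h1]
    exact (hI n').out hz.2.2 hz.2.1 ⟨by linarith, by linarith⟩
  have hseg : ∀ a : ℝ, η.IsDeveloped (line (w m' - a * w n'))
      (fun σ : ℝ => F n' (z + σ * (q - a))) (Icc 0 1) := fun a =>
    (hF n').comp (φ := fun σ : ℝ => (z + σ * (q - a) : ℂ)) (by fun_prop)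
      (fun σ hσ => hmem σ hσ a) fun σ _ σ' _ => by
        simp only [ContinuousLinearMap.toSpanSingleton_apply, Complex.real_smul,
          ContinuousLinearMap.mul_apply']
        rw [← hqw]
        push_cast
        ring
  -- The closed geodesic of the second cylinder through `x` also runs inside the first one.
  have h1 : F n' (z + q) = x := by
    have h2 : η.IsDeveloped (line (w m')) (fun t : ℝ => F m' (t + z')) univ := by
      have := (hF m').horizontal hz'.1 z'.re
      convert! this using 3 with t
      rw [add_assoc, Complex.re_add_im]
    have h3 : η.IsDeveloped (line (w m')) (fun σ : ℝ => F n' (z + σ * q)) (Icc 0 1) := by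
      simpa using hseg 0
    have := h3.eqOn (h2.mono (subset_univ _)) isPreconnected_Icc (left_mem_Icc.2 zero_le_one)
      (by simp [hzx, hzx']) (right_mem_Icc.2 zero_le_one)
    have h4 := hper m' z' hz'.1
    rw [add_comm] at h4
    simpa [h4, hzx'] using this
  have h2 : F n' (z + (q - 1)) = x := by
    have h3 := hmem 1 (right_mem_Icc.2 zero_le_one) 1
    rw [Complex.ofReal_one, one_mul] at h3
    rw [← hper n' _ h3, ← h1]
    congr 1
    ring
  have h3 : η.IsDeveloped (line (w m' - w n')) (fun σ : ℝ => e.symm (e x +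
      line (w m' - w n') σ)) (Icc 0 1) := by
    refine (he.isDeveloped_symm _ _).mono fun σ hσ => hb ?_
    rw [mem_ball_iff_norm, add_sub_cancel_left, ContinuousLinearMap.toSpanSingleton_apply,
      norm_smul, Real.norm_eq_abs, abs_of_nonneg hσ.1]
    exact (mul_le_of_le_one_left (norm_nonneg _) hσ.2).trans_lt
      (hwnm.trans_le (min_le_right _ _))
  have h4 := hseg 1
  rw [Complex.ofReal_one, one_mul] at h4
  have h5 := h4.eqOn h3 isPreconnected_Icc (left_mem_Icc.2 zero_le_one)
    (by simp [hzx, e.left_inv hxe]) (right_mem_Icc.2 zero_le_one)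
  simp only [Complex.ofReal_one, one_mul, h2, ContinuousLinearMap.toSpanSingleton_apply,
    one_smul] at h5
  have h6 : e x + (w m' - w n') ∈ e.target := by
    refine hb ?_
    rw [mem_ball_iff_norm, add_sub_cancel_left]
    exact hwnm.trans_le (min_le_right _ _)
  have h7 : e x = e x + (w m' - w n') := by
    conv_lhs => rw [h5]
    exact e.right_inv h6
  have h8 : w m' = w n' := by linear_combination -h7
  have hxC : x ∈ C n' := by rw [hCF n']; exact ⟨z, hz.1, hzx⟩
  have hxC' : x ∈ C m' := by rw [hCF m']; exact ⟨z', hz'.1, hzx'⟩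
  exact hne ((hcyl n').eq_of_mem (h8 ▸ hcyl m') hxC hxC')

end AbelianDifferential

end LongCylinders

/-! ### Translation covers -/

section Covers

/-- The derivative of an injective holomorphic function does not vanish. -/
theorem _root_.OpenPartialHomeomorph.deriv_ne_zero_of_holomorphic (e : OpenPartialHomeomorph ℂ ℂ)
    {f : ℂ → ℂ} (hf : ∀ z ∈ e.source, HasDerivAt e (f z) z) {z : ℂ} (hz : z ∈ e.source) :
    f z ≠ 0 := by
  intro h0
  have hfd : DifferentiableOn ℂ e e.source := fun z hz =>
    (hf z hz).differentiableAt.differentiableWithinAt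
  have hder : EqOn (deriv e) f e.source := fun z hz => (hf z hz).deriv
  have han : AnalyticAt ℂ (deriv e) z :=
    (hfd.analyticOnNhd e.open_source).deriv z hz
  have hne : ∀ᶠ y in 𝓝[≠] z, deriv e y ≠ 0 := by
    refine han.eventually_eq_zero_or_eventually_ne_zero.resolve_left fun h => ?_
    -- Otherwise `e` would be locally constant.
    obtain ⟨r, hr, hb⟩ := Metric.eventually_nhds_iff_ball.1 (h.and (e.open_source.mem_nhds hz))
    have h1 : z + (r / 2 : ℝ) ∈ Metric.ball z r := by
      rw [mem_ball_iff_norm, add_sub_cancel_left, Complex.norm_real, Real.norm_eq_abs,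
        abs_of_pos (half_pos hr)]
      linarith
    have h2 := Metric.isOpen_ball.is_const_of_deriv_eq_zero (convex_ball z r).isPreconnected
      (fun y hy => hfd.differentiableAt (e.open_source.mem_nhds (hb y hy).2)
        |>.differentiableWithinAt) (fun y hy => (hb y hy).1) h1 (Metric.mem_ball_self hr)
    have h3 := e.injOn (hb _ h1).2 hz h2
    rw [add_eq_left, Complex.ofReal_eq_zero] at h3
    linarith
  -- The inverse is holomorphic off `e z`, hence everywhere, and the chain rule fails at `z`.
  have hez := e.map_source hz
  have hinv : DifferentiableAt ℂ e.symm (e z) := by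
    have hc := e.symm.continuousAt hez
    refine (Complex.analyticAt_of_differentiable_on_punctured_nhds_of_continuousAt ?_
      hc).differentiableAt
    have ht : Tendsto e.symm (𝓝[≠] (e z)) (𝓝[≠] z) := by
      refine tendsto_nhdsWithin_iff.2 ⟨?_, ?_⟩
      · have := hc.tendsto
        rw [e.left_inv hz] at this
        exact this.mono_left nhdsWithin_le_nhds
      · filter_upwards [self_mem_nhdsWithin,
          mem_nhdsWithin_of_mem_nhds (e.open_target.mem_nhds hez)] with u hu hut h
        exact hu (by rw [← e.right_inv hut, h]; rfl)
    filter_upwards [ht hne, mem_nhdsWithin_of_mem_nhds (e.open_target.mem_nhds hez)] with u hu hut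
    have h3 := hf _ (e.map_target hut)
    rw [← hder (e.map_target hut)] at h3
    exact (e.hasDerivAt_symm hut hu h3).differentiableAt
  have h1 := hinv.hasDerivAt.comp z (hf z hz)
  have h2 : HasDerivAt (e.symm ∘ e) 1 z := (hasDerivAt_id z).congr_of_eventuallyEq (by
    filter_upwards [e.open_source.mem_nhds hz] with y hy
    exact e.left_inv hy)
  rw [h0, mul_zero] at h1
  exact zero_ne_one (h1.unique h2)

section Surface

variable {X : Type*} [TopologicalSpace X] [ChartedSpace ℂ X] [IsManifold 𝓘(ℂ, ℂ) ω X]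
  {η : AbelianDifferential X}

/-- Natural coordinates contain no zeros of the differential, which are branch points of its
primitives. -/
theorem AbelianDifferential.IsNaturalChart.isRegularChart {e : OpenPartialHomeomorph X ℂ}
    (he : η.IsNaturalChart e) : η.IsRegularChart e := by
  refine ⟨he, fun x hx h => ?_⟩
  set φ := chartAt ℂ x with hφ
  have hxφ : x ∈ φ.source := mem_chart_source ℂ x
  refine (φ.symm.trans e).deriv_ne_zero_of_holomorphic (f := η.coeff φ) (fun z hz => ?_)
    (z := φ x) ?_ ((coeff_eq_zero_iff (chart_mem_atlas ℂ x) hxφ).2 h)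
  · rw [OpenPartialHomeomorph.trans_source] at hz
    exact he.hasDerivAt_comp_symm (chart_mem_atlas ℂ x) hz.1 hz.2
  · rw [OpenPartialHomeomorph.trans_source]
    exact ⟨φ.map_source hxφ, by simpa [φ.left_inv hxφ] using hx⟩

end Surface

variable {M : Type*} [TopologicalSpace M] [ChartedSpace ℂ M] [IsManifold 𝓘(ℂ, ℂ) ω M]
  {N : Type*} [TopologicalSpace N] [ChartedSpace ℂ N] [IsManifold 𝓘(ℂ, ℂ) ω N]
  [AddAction (ℤ × ℤ) N] {η : AbelianDifferential M} {ηN : AbelianDifferential N}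
  {γ₁ γ₂ : H1 M} {p : N → M}
  {E : Type*} [NormedAddCommGroup E] [NormedSpace ℝ E] {L : E →L[ℝ] ℂ} {f : E → N} {S : Set E}

namespace IsZ2Cover

open AbelianDifferential

omit [IsManifold 𝓘(ℂ, ℂ) ω M] [IsManifold 𝓘(ℂ, ℂ) ω N] in
/-- Natural coordinates of the base, composed with local inverses of the covering map, are natural
coordinates of the cover. -/
theorem isNaturalChart_trans (hp : IsZ2Cover η γ₁ γ₂ ηN p) {q : OpenPartialHomeomorph N M}
    (hq : (q : N → M) = p) {e : OpenPartialHomeomorph M ℂ} (he : η.IsNaturalChart e) :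
    ηN.IsNaturalChart (q.trans e) := fun y hy => by
  rw [OpenPartialHomeomorph.trans_source, mem_inter_iff, mem_preimage, hq] at hy
  have h := (he (p y) hy.2).comp y (hp.holomorphic y).hasMFDerivAt
  rw [OpenPartialHomeomorph.coe_trans, hq, hp.pullback y]
  exact h

omit [IsManifold 𝓘(ℂ, ℂ) ω M] [IsManifold 𝓘(ℂ, ℂ) ω N] in
theorem exists_local_homeomorph (hp : IsZ2Cover η γ₁ γ₂ ηN p) (y : N) :
    ∃ q : OpenPartialHomeomorph N M, y ∈ q.source ∧ (q : N → M) = p := by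
  obtain ⟨q, hy, hq⟩ := hp.isCoveringMap.isLocalHomeomorph y
  exact ⟨q, hy, hq.symm⟩

theorem mem_zeros_iff (hp : IsZ2Cover η γ₁ γ₂ ηN p) (y : N) : y ∈ ηN.zeros ↔ p y ∈ η.zeros := by
  constructor
  · intro hy
    by_contra hn
    obtain ⟨e, he, hye⟩ := η.exists_isRegularChart hn
    obtain ⟨q, hyq, hq⟩ := hp.exists_local_homeomorph y
    refine (hp.isNaturalChart_trans hq he.1).isRegularChart.2 y ?_ hy
    rw [OpenPartialHomeomorph.trans_source]
    exact ⟨hyq, by rwa [mem_preimage, hq]⟩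
  · intro hy
    have h : η.form (p y) = 0 := hy
    have h2 := hp.pullback y
    rw [h] at h2
    exact h2

/-- A continuous map to the cover is developed if and only if its projection to the base is. -/
theorem isDeveloped_iff (hp : IsZ2Cover η γ₁ γ₂ ηN p) (hf : ContinuousOn f S) :
    ηN.IsDeveloped L f S ↔ η.IsDeveloped L (p ∘ f) S := by
  have key : ∀ z ∈ S, p (f z) ∉ η.zeros → ∃ e, η.IsRegularChart e ∧ p (f z) ∈ e.source ∧
      ∃ q : OpenPartialHomeomorph N M, f z ∈ (q.trans e).source ∧ (q : N → M) = p ∧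
        ηN.IsRegularChart (q.trans e) := fun z hz hreg => by
    obtain ⟨e, he, hze⟩ := η.exists_isRegularChart hreg
    obtain ⟨q, hzq, hq⟩ := hp.exists_local_homeomorph (f z)
    refine ⟨e, he, hze, q, ?_, hq, (hp.isNaturalChart_trans hq he.1).isRegularChart⟩
    rw [OpenPartialHomeomorph.trans_source]
    exact ⟨hzq, by rwa [mem_preimage, hq]⟩
  constructor
  · intro h z hz
    obtain ⟨e, he, hze, q, hzq, hq, hqe⟩ := key z hz
      fun h0 => h.notMem_zeros hz ((hp.mem_zeros_iff _).2 h0)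
    refine ⟨e, he, hze, ?_⟩
    filter_upwards [h.eventually_chart hz hqe.1 hzq] with y hy
    rw [OpenPartialHomeomorph.trans_source, mem_inter_iff, mem_preimage,
      OpenPartialHomeomorph.coe_trans, hq] at hy
    exact ⟨hy.1.2, hy.2⟩
  · intro h z hz
    obtain ⟨e, he, hze, q, hzq, hq, hqe⟩ := key z hz (h.notMem_zeros hz)
    refine ⟨q.trans e, hqe, hzq, ?_⟩
    have hqz : f z ∈ q.source := by
      rw [OpenPartialHomeomorph.trans_source] at hzq
      exact hzq.1
    filter_upwards [h.eventually_chart hz he.1 hze, hf z hz (q.open_source.mem_nhds hqz)]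
      with y hy hyq
    rw [OpenPartialHomeomorph.trans_source, mem_inter_iff, mem_preimage,
      OpenPartialHomeomorph.coe_trans, hq]
    exact ⟨⟨hyq, hy.1⟩, hy.2⟩

theorem vadd_isDeveloped (hp : IsZ2Cover η γ₁ γ₂ ηN p) (hf : ηN.IsDeveloped L f S) (n : ℤ × ℤ) :
    ηN.IsDeveloped L (fun z => n +ᵥ f z) S := by
  refine (hp.isDeveloped_iff ((hp.continuous_deck n).comp_continuousOn hf.continuousOn)).2 ?_
  exact ((hp.isDeveloped_iff hf.continuousOn).1 hf).congr fun z _ => hp.deck n (f z)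

theorem vadd_flowsTo (hp : IsZ2Cover η γ₁ γ₂ ηN p) {θ t : ℝ} {x y : N}
    (h : ηN.FlowsTo θ t x y) (n : ℤ × ℤ) : ηN.FlowsTo θ t (n +ᵥ x) (n +ᵥ y) := by
  rw [flowsTo_iff] at h ⊢
  obtain ⟨c, h0, h1, hc⟩ := h
  exact ⟨fun s => n +ᵥ c s, congrArg _ h0, congrArg _ h1, hp.vadd_isDeveloped hc n⟩

omit [IsManifold 𝓘(ℂ, ℂ) ω M] [IsManifold 𝓘(ℂ, ℂ) ω N] in
theorem t2Space [T2Space M] (hp : IsZ2Cover η γ₁ γ₂ ηN p) : T2Space N := by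
  refine ⟨fun x y hxy => ?_⟩
  by_cases h : p x = p y
  · exact hp.isCoveringMap.isSeparatedMap x y h hxy
  · exact separated_by_continuous hp.isCoveringMap.continuous h

omit [IsManifold 𝓘(ℂ, ℂ) ω M] [IsManifold 𝓘(ℂ, ℂ) ω N] in
/-- The cover is second countable: it is the union of the countably many deck translates of
countably many domains that are mapped homeomorphically to the base. -/
theorem secondCountableTopology [SecondCountableTopology M] (hp : IsZ2Cover η γ₁ γ₂ ηN p) :
    SecondCountableTopology N := by
  have : Nonempty M := ⟨η.nonzero.choose⟩
  choose σ hσ using hp.surjective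
  choose q hq hqp using fun x : M => hp.exists_local_homeomorph (σ x)
  have hopen : ∀ x, IsOpen (p '' (q x).source) := fun x =>
    hp.isCoveringMap.isOpenMap _ (q x).open_source
  obtain ⟨a, ha⟩ := (isLindelof_univ (X := M)).indexed_countable_subcover
    (fun x => p '' (q x).source) hopen fun x _ => mem_iUnion.2 ⟨x, σ x, hq x, hσ x⟩
  set U : ℕ × (ℤ × ℤ) → Set N := fun i => (fun y => i.2 +ᵥ y) ⁻¹' (q (a i.1)).source with hU
  have hUo : ∀ i, IsOpen (U i) := fun i => (q _).open_source.preimage (hp.continuous_deck _)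
  have hUs : ∀ i, SecondCountableTopology (U i) := fun i => by
    have hemb : IsOpenEmbedding fun y : U i => p y := by
      refine IsOpenEmbedding.of_continuous_injective_isOpenMap
        (hp.isCoveringMap.continuous.comp continuous_subtype_val) ?_
        (hp.isCoveringMap.isOpenMap.comp (hUo i).isOpenMap_subtype_val)
      rintro ⟨x, hx⟩ ⟨y, hy⟩ hxy
      have h1 : q (a i.1) (i.2 +ᵥ x) = q (a i.1) (i.2 +ᵥ y) := by
        rw [hqp, hp.deck, hp.deck]
        exact hxy
      have h2 := (q (a i.1)).injOn hx hy h1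
      exact Subtype.ext (vadd_left_cancel _ h2)
    exact hemb.isEmbedding.secondCountableTopology
  refine TopologicalSpace.secondCountableTopology_of_countable_cover hUo (univ_subset_iff.1 ?_)
  intro y _
  obtain ⟨i, hi⟩ := mem_iUnion.1 (ha (mem_univ (p y)))
  obtain ⟨y', hy', hyy'⟩ := hi
  obtain ⟨n, hn, -⟩ := hp.fibre y y' hyy'.symm
  exact mem_iUnion.2 ⟨(i, n), by simpa [hU, hn] using hy'⟩

/-- Developed curves and strips lift to the cover. -/
theorem exists_lift (hp : IsZ2Cover η γ₁ γ₂ ηN p) (hS : Convex ℝ S) {g : E → M}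
    (hg : η.IsDeveloped L g S) {z₀ : E} (hz₀ : z₀ ∈ S) {y₀ : N} (hy₀ : p y₀ = g z₀) :
    ∃ G : E → N, G z₀ = y₀ ∧ (∀ z ∈ S, p (G z) = g z) ∧ ηN.IsDeveloped L G S := by
  classical
  have := hS.contractibleSpace ⟨z₀, hz₀⟩
  have := hS.locallyPathConnectedSpace
  obtain ⟨G, ⟨hG0, hG⟩, -⟩ := hp.isCoveringMap.existsUnique_continuousMap_lifts
    ⟨S.domRestrict g, hg.continuousOn.domRestrict⟩ ⟨z₀, hz₀⟩ y₀ hy₀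
  have hGS : ∀ z (hz : z ∈ S), p (G ⟨z, hz⟩) = g z := fun z hz => congrFun hG ⟨z, hz⟩
  set G' : E → N := fun z => if hz : z ∈ S then G ⟨z, hz⟩ else y₀ with hG'
  have hG'S : ∀ z (hz : z ∈ S), G' z = G ⟨z, hz⟩ := fun z hz => dif_pos hz
  have hc : ContinuousOn G' S := by
    rw [continuousOn_iff_continuous_domRestrict]
    convert! G.continuous using 1
    ext z
    exact hG'S z z.2
  refine ⟨G', by rw [hG'S _ hz₀, hG0], fun z hz => by rw [hG'S z hz, hGS], ?_⟩
  rw [hp.isDeveloped_iff hc]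
  exact hg.congr fun z hz => by
    change p (G' z) = g z
    rw [hG'S z hz, hGS]

/-- Trajectories of the directional flow lift to the cover. -/
theorem exists_flowsTo (hp : IsZ2Cover η γ₁ γ₂ ηN p) {θ t : ℝ} {x : N} {y : M}
    (h : η.FlowsTo θ t (p x) y) : ∃ y', p y' = y ∧ ηN.FlowsTo θ t x y' := by
  rw [flowsTo_iff] at h
  obtain ⟨c, h0, h1, hc⟩ := h
  obtain ⟨C, hC0, hCp, hC⟩ := hp.exists_lift (convex_uIcc 0 t) hc left_mem_uIcc h0.symm
  exact ⟨C t, by rw [hCp _ right_mem_uIcc, h1], flowsTo_iff.2 ⟨C, hC0, rfl, hC⟩⟩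

end IsZ2Cover

end Covers

/-! ### Area and the covering map -/

section CoverArea

variable {M : Type*} [TopologicalSpace M] [ChartedSpace ℂ M] [IsManifold 𝓘(ℂ, ℂ) ω M]
  [MeasurableSpace M] [BorelSpace M]
  {N : Type*} [TopologicalSpace N] [ChartedSpace ℂ N] [IsManifold 𝓘(ℂ, ℂ) ω N]
  [MeasurableSpace N] [BorelSpace N]
  [AddAction (ℤ × ℤ) N] {η : AbelianDifferential M} {ηN : AbelianDifferential N}
  {γ₁ γ₂ : H1 M} {p : N → M}

namespace IsZ2Cover

open AbelianDifferential

/-- The covering map preserves the areas of sets that it maps injectively into a natural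
coordinate. -/
theorem area_image_eq [SecondCountableTopology M] (hp : IsZ2Cover η γ₁ γ₂ ηN p)
    {q : OpenPartialHomeomorph N M} (hq : (q : N → M) = p) {e : OpenPartialHomeomorph M ℂ}
    (he : η.IsNaturalChart e) {B : Set N} (hB : MeasurableSet B) (hBs : B ⊆ (q.trans e).source) :
    MeasurableSet (p '' B) ∧ η.area (p '' B) = ηN.area B := by
  have := hp.secondCountableTopology
  rw [OpenPartialHomeomorph.trans_source] at hBs
  have hm : MeasurableSet (p '' B) := by
    rw [← hq]
    exact q.measurableSet_image hB fun x hx => (hBs hx).1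
  refine ⟨hm, ?_⟩
  rw [he.area_eq hm, (hp.isNaturalChart_trans hq he).area_eq hB (by
    rwa [OpenPartialHomeomorph.trans_source]), OpenPartialHomeomorph.coe_trans, hq, image_comp]
  rintro _ ⟨x, hx, rfl⟩
  have := (hBs hx).2
  rwa [mem_preimage, hq] at this

/-- The regular part of the cover is covered by a sequence of flat discs, each contained in the
concentric disc of twice the radius, on which the covering map preserves areas. -/
theorem exists_disc_cover [SecondCountableTopology M] (hp : IsZ2Cover η γ₁ γ₂ ηN p) :
    ∃ (Q : ℕ → OpenPartialHomeomorph N ℂ) (c : ℕ → ℂ) (r : ℕ → ℝ), (∀ i, ηN.IsRegularChart (Q i) ∧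
      0 < r i ∧ Metric.ball (c i) (2 * r i) ⊆ (Q i).target ∧
      ∀ B ⊆ (Q i).source, MeasurableSet B →
        MeasurableSet (p '' B) ∧ η.area (p '' B) = ηN.area B) ∧
      ηN.zerosᶜ ⊆ ⋃ i, (Q i).source ∩ Q i ⁻¹' Metric.ball (c i) (r i) := by
  have := hp.secondCountableTopology
  have : Nonempty N := ⟨ηN.nonzero.choose⟩
  have key : ∀ y : N, ∃ (Q : OpenPartialHomeomorph N ℂ) (c : ℂ) (r : ℝ), y ∉ ηN.zeros →
      (ηN.IsRegularChart Q ∧ 0 < r ∧ Metric.ball c (2 * r) ⊆ Q.target ∧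
      ∀ B ⊆ Q.source, MeasurableSet B →
        MeasurableSet (p '' B) ∧ η.area (p '' B) = ηN.area B) ∧
      y ∈ Q.source ∩ Q ⁻¹' Metric.ball c r := by
    intro y
    by_cases hy : y ∈ ηN.zeros
    · exact ⟨chartAt ℂ y, 0, 0, fun h => (h hy).elim⟩
    obtain ⟨e, he, hye⟩ := η.exists_isRegularChart (fun h => hy ((hp.mem_zeros_iff y).2 h))
    obtain ⟨q, hyq, hq⟩ := hp.exists_local_homeomorph y
    have hys : y ∈ (q.trans e).source := by
      rw [OpenPartialHomeomorph.trans_source]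
      exact ⟨hyq, by rwa [mem_preimage, hq]⟩
    obtain ⟨R, hR, hb⟩ := Metric.isOpen_iff.1 (q.trans e).open_target _
      ((q.trans e).map_source hys)
    refine ⟨q.trans e, (q.trans e) y, R / 2, fun _ =>
      ⟨⟨(hp.isNaturalChart_trans hq he.1).isRegularChart, half_pos hR, ?_,
        fun B hBs hB => hp.area_image_eq hq he.1 hB hBs⟩,
        hys, Metric.mem_ball_self (half_pos hR)⟩⟩
    rwa [mul_div_cancel₀ R two_ne_zero]
  choose Q c r hQ using key
  have : Nonempty (ηN.zerosᶜ : Set N) := ⟨⟨ηN.nonzero.choose, ηN.nonzero.choose_spec⟩⟩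
  obtain ⟨f, hf⟩ := (HereditarilyLindelofSpace.isLindelof ηN.zerosᶜ).indexed_countable_subcover
    (fun y : (ηN.zerosᶜ : Set N) => (Q y).source ∩ Q y ⁻¹' Metric.ball (c y) (r y))
    (fun y => (Q y).isOpen_inter_preimage Metric.isOpen_ball)
    fun y hy => mem_iUnion.2 ⟨⟨y, hy⟩, (hQ y hy).2⟩
  exact ⟨fun i => Q (f i), fun i => c (f i), fun i => r (f i), fun i => (hQ _ (f i).2).1, hf⟩

theorem measurableSet_image [SecondCountableTopology M] (hp : IsZ2Cover η γ₁ γ₂ ηN p) {B : Set N}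
    (hB : MeasurableSet B) (hBz : ∀ x ∈ B, x ∉ ηN.zeros) : MeasurableSet (p '' B) := by
  obtain ⟨Q, c, r, hQ, hcov⟩ := hp.exists_disc_cover
  have h1 : p '' B = ⋃ i, p '' (B ∩ (Q i).source) := by
    rw [← image_iUnion, ← inter_iUnion, inter_eq_left.2]
    exact fun x hx => iUnion_mono (fun i => inter_subset_left) (hcov (hBz x hx))
  rw [h1]
  exact MeasurableSet.iUnion fun i => ((hQ i).2.2.2 _ inter_subset_right
    (hB.inter (Q i).open_source.measurableSet)).1

theorem area_eq_zero_of_image [SecondCountableTopology M] (hp : IsZ2Cover η γ₁ γ₂ ηN p) {B : Set N}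
    (hB : MeasurableSet B) (h : η.area (p '' (B \ ηN.zeros)) = 0) : ηN.area B = 0 := by
  have := hp.secondCountableTopology
  obtain ⟨Q, c, r, hQ, hcov⟩ := hp.exists_disc_cover
  have h1 : B ⊆ ηN.zeros ∪ ⋃ i, (B \ ηN.zeros) ∩ (Q i).source := by
    intro x hx
    by_cases hxz : x ∈ ηN.zeros
    · exact Or.inl hxz
    · rw [← inter_iUnion]
      exact Or.inr ⟨⟨hx, hxz⟩, iUnion_mono (fun i => inter_subset_left) (hcov hxz)⟩
  refine measure_mono_null h1 (measure_union_null ηN.area_zeros (measure_iUnion_null fun i => ?_))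
  rw [← ((hQ i).2.2.2 _ inter_subset_right ((hB.diff ηN.isClosed_zeros.measurableSet).inter
    (Q i).open_source.measurableSet)).2]
  exact measure_mono_null (image_mono inter_subset_left) h

end IsZ2Cover

end CoverArea

/-! ### Return maps of strips -/

section Strips

/-- Translations act continuously on sets of finite measure. -/
theorem tendsto_volume_symmDiff_translate {A : Set ℂ} (hA : MeasurableSet A)
    (hA' : volume A ≠ ⊤) :
    Tendsto (fun d : ℂ => volume (symmDiff ((fun z => z + d) ⁻¹' A) A)) (𝓝 0) (𝓝 0) := by
  have hc : Continuous fun d : ℂ => (⟨fun z => z + d, by fun_prop⟩ : C(ℂ, ℂ)) :=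
    ContinuousMap.continuous_of_continuous_uncurry _ (by
      change Continuous fun q : ℂ × ℂ => q.2 + q.1
      fun_prop)
  have h := tendsto_measure_symmDiff_preimage_nhds_zero (μ := volume) (ν := volume)
    (g := ⟨fun z => z + 0, by fun_prop⟩) (hc.tendsto 0)
    (Eventually.of_forall fun d => measurePreserving_add_right volume d)
    (measurePreserving_add_right volume 0) hA.nullMeasurableSet hA'
  simpa using h

variable {M : Type*} [TopologicalSpace M] [ChartedSpace ℂ M] [IsManifold 𝓘(ℂ, ℂ) ω M]
  {N : Type*} [TopologicalSpace N] [ChartedSpace ℂ N] [IsManifold 𝓘(ℂ, ℂ) ω N]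
  [AddAction (ℤ × ℤ) N] {η : AbelianDifferential M} {ηN : AbelianDifferential N}
  {γ₁ γ₂ : H1 M} {p : N → M}

namespace IsZ2Cover

open AbelianDifferential

omit [IsManifold 𝓘(ℂ, ℂ) ω M] in
/-- In a flat disc of the cover, the points that a displacement by a small vector `d` followed by
the deck transformation `k` maps back to the side of `A` they come from, although `k` alone does
not, form a set of small area: translations are continuous in measure. -/
theorem eventually_area_le [MeasurableSpace N] [BorelSpace N] [SecondCountableTopology N]
    (hp : IsZ2Cover η γ₁ γ₂ ηN p) {Q : OpenPartialHomeomorph N ℂ} (hQ : ηN.IsRegularChart Q)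
    {c : ℂ} {r : ℝ} (hr : 0 < r) (hb : Metric.ball c (2 * r) ⊆ Q.target) {A : Set N}
    (hA : MeasurableSet A) (k : ℤ × ℤ) {ε : ENNReal} (hε : 0 < ε) :
    ∀ᶠ d in 𝓝 (0 : ℂ), ∀ B ⊆ Q.source ∩ Q ⁻¹' Metric.ball c r, MeasurableSet B →
      (∀ x ∈ B, ¬(x ∈ A ↔ k +ᵥ x ∈ A)) → (∀ x ∈ B, x ∈ A ↔ k +ᵥ Q.symm (Q x + d) ∈ A) →
      ηN.area B ≤ ε := by
  set A' : Set N := (fun x => k +ᵥ x) ⁻¹' A with hA'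
  have hA'm : MeasurableSet A' := (hp.continuous_deck k).measurable hA
  set S := Q '' (A' ∩ Q.source) ∩ Metric.ball c (2 * r) with hS
  have hSm : MeasurableSet S :=
    (Q.measurableSet_image (hA'm.inter Q.open_source.measurableSet) inter_subset_right).inter
      measurableSet_ball
  have hSf : volume S ≠ ⊤ := (measure_mono inter_subset_right).trans_lt measure_ball_lt_top |>.ne
  have hmem : ∀ z ∈ Metric.ball c (2 * r), z ∈ S ↔ k +ᵥ Q.symm z ∈ A := fun z hz => by
    constructor
    · rintro ⟨⟨x, hx, rfl⟩, -⟩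
      rw [Q.left_inv hx.2]
      exact hx.1
    · intro h
      exact ⟨⟨Q.symm z, ⟨h, Q.map_target (hb hz)⟩, Q.right_inv (hb hz)⟩, hz⟩
  filter_upwards [(tendsto_volume_symmDiff_translate hSm hSf).eventually_le_const hε,
    Metric.ball_mem_nhds (0 : ℂ) hr] with d hd hdr B hBs hB h1 h2
  rw [hQ.1.area_eq hB (hBs.trans inter_subset_left)]
  refine (measure_mono ?_).trans hd
  rintro _ ⟨x, hx, rfl⟩
  have hxr : dist (Q x) c < r := (hBs hx).2
  have hz1 : Q x ∈ Metric.ball c (2 * r) := by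
    rw [Metric.mem_ball]
    linarith
  have hz2 : Q x + d ∈ Metric.ball c (2 * r) := by
    rw [mem_ball_zero_iff] at hdr
    rw [mem_ball_iff_norm, add_sub_right_comm]
    rw [dist_eq_norm] at hxr
    linarith [norm_add_le (Q x - c) d]
  have h3 := hmem _ hz1
  rw [Q.left_inv (hBs hx).1] at h3
  have h4 := (hmem _ hz2).trans (h2 x hx).symm
  have h5 := h1 x hx
  rw [mem_symmDiff, mem_preimage, h3, h4]
  tauto

/-- A lift of the strip over a cylinder is translated by `k` when one runs once around. -/
theorem lift_add_one [T2Space M] (hp : IsZ2Cover η γ₁ γ₂ ηN p) {w : ℂ} {F : ℂ → M} {I : Set ℝ}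
    (hI : I.OrdConnected) (hF : η.IsDeveloped (scale w) F (strip I))
    (g : ClosedGeodesic η w) (hg : range g.toFun ⊆ F '' strip I) {G : ℂ → N}
    (hG : ηN.IsDeveloped (scale w) G (strip I)) (hGF : ∀ z ∈ strip I, p (G z) = F z) :
    ∀ z ∈ strip I, G (z + 1) =
      (intersection γ₁ g.homologyClass, intersection γ₂ g.homologyClass) +ᵥ G z := by
  have := hp.t2Space
  obtain ⟨z₁, hz₁, hgz₁⟩ := hg ⟨0, rfl⟩
  have hGh := hG.horizontal hz₁ z₁.re
  have hline : ∀ t : ℝ, (t + z₁.re + z₁.im * Complex.I : ℂ) = t + z₁ := fun t => by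
    rw [add_assoc, Complex.re_add_im]
  simp only [hline] at hGh
  have hFh := hF.horizontal hz₁ z₁.re
  simp only [hline] at hFh
  have hmem : ∀ t : ℝ, (t + z₁ : ℂ) ∈ strip I := fun t => by
    have : z₁.im ∈ I := hz₁
    simpa [strip] using this
  have hgF := hFh.eqOn g.isDeveloped isPreconnected_univ (mem_univ 0) (by simpa using hgz₁)
  have hmon := hp.monodromy g.toClosedCurve (fun t : ℝ => G (t + z₁))
    (continuousOn_univ.1 hGh.continuousOn) fun t => (hGF _ (hmem t)).trans (hgF (mem_univ t))
  have h1 : ηN.IsDeveloped (scale w) (fun z => G (z + 1)) (strip I) :=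
    (hG.comp_add_right 1).mono fun z hz => by
      have : z.im ∈ I := hz
      simpa [strip] using this
  refine h1.eqOn (hp.vadd_isDeveloped hG _) (isPreconnected_strip hI) hz₁ ?_
  rw [add_comm z₁ 1]
  simpa using hmon

/-- Flowing along a strip: on a large part `U` of a cylinder `C`, the flow in direction `θ` returns
after a fixed time to the original point displaced by a small vector `d`; in the cover, it arrives
at the translate by `k` of the displaced point. -/
theorem exists_return [T2Space M] [SecondCountableTopology M] [MeasurableSpace M] [BorelSpace M]
    (hp : IsZ2Cover η γ₁ γ₂ ηN p) {w : ℂ} {C : Set M}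
    (hC : IsCylinder η w C) (g : ClosedGeodesic η w) (hg : range g.toFun ⊆ C) (θ : ℝ) :
    ∃ U : Set M, IsOpen U ∧
      η.area C ≤ η.area U +
        ENNReal.ofReal (‖w‖ * |Real.cos θ * w.im - Real.sin θ * w.re|) ∧
      ∃ (T : ℝ) (d : ℂ), ‖d‖ = |Real.cos θ * w.im - Real.sin θ * w.re| ∧
        ∀ x, p x ∈ U → ∃ c : ℝ → N, ηN.IsDeveloped (line d) c (Icc 0 1) ∧ c 0 = x ∧
          ηN.FlowsTo θ T x
            ((intersection γ₁ g.homologyClass, intersection γ₂ g.homologyClass) +ᵥ c 1) := by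
  obtain ⟨hw, I, F, hIo, hI, hF, hper, rfl⟩ := hC.exists_strip
  have hw0 : 0 < ‖w‖ := norm_pos_iff.2 hw
  set b := Real.cos θ * w.im - Real.sin θ * w.re with hb
  set T := Real.cos θ * w.re + Real.sin θ * w.im with hT
  set u := Complex.exp (θ * Complex.I) with hu
  have hu' : u = Real.cos θ + Real.sin θ * Complex.I := by
    rw [hu, Complex.exp_mul_I, Complex.ofReal_cos, Complex.ofReal_sin]
  set d := T * u - w with hd
  -- In the frame of the direction `θ`, the vector `w` has the components `T` and `b`.
  have hdb : d = -(b * Complex.I * u) := by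
    have h := Real.sin_sq_add_cos_sq θ
    rw [hd, hu']
    apply Complex.ext
    · simp [hT, hb, -Complex.ofReal_cos, -Complex.ofReal_sin]
      linear_combination w.re * h
    · simp [hT, hb, -Complex.ofReal_cos, -Complex.ofReal_sin]
      linear_combination w.im * h
  have hdn : ‖d‖ = |b| := by
    rw [hdb, norm_neg, norm_mul, norm_mul, hu, Complex.norm_exp_ofReal_mul_I]
    simp
  set δ := (d / w).im with hδ
  have hδb : ‖w‖ ^ 2 * |δ| ≤ ‖w‖ * |b| := by
    have h1 : |δ| ≤ |b| / ‖w‖ := by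
      rw [← hdn, ← norm_div]
      exact Complex.abs_im_le_norm _
    calc ‖w‖ ^ 2 * |δ| ≤ ‖w‖ ^ 2 * (|b| / ‖w‖) := by gcongr
      _ = ‖w‖ * |b| := by field_simp
  have hdw : d / w = T * (u / w) - 1 := by
    rw [hd]
    field_simp
  refine ⟨F '' {z | z.im ∈ I ∧ z.im + δ ∈ I}, ?_, ?_, T, d, hdn, ?_⟩
  · exact (hF.mono fun z hz => hz.1).isOpen_image hw
      ((isOpen_strip hIo).inter (hIo.preimage (f := fun z : ℂ => z.im + δ) (by fun_prop)))
  · have hcov : F '' strip I ⊆ F '' {z | z.im ∈ I ∧ z.im + δ ∈ I} ∪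
        F '' {z | z.im ∈ I ∧ z.im + δ ∉ I} := by
      rw [← image_union]
      refine image_mono fun z hz => ?_
      by_cases h : z.im + δ ∈ I
      · exact Or.inl ⟨hz, h⟩
      · exact Or.inr ⟨hz, h⟩
    refine (measure_mono hcov).trans ((measure_union_le _ _).trans ?_)
    gcongr
    exact (hF.area_image_add_notMem_le hw hIo hI hper δ).trans (ENNReal.ofReal_le_ofReal hδb)
  · rintro x ⟨z, ⟨hz, hzδ⟩, hzx⟩
    obtain ⟨G, hGz, hGF, hG⟩ := hp.exists_lift (convex_strip hI) hF (z₀ := z) hz hzx.symm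
    have hG1 := hp.lift_add_one hI hF g hg hG hGF
    have hconv : ∀ σ ∈ Icc (0 : ℝ) 1, z.im + σ * δ ∈ I := fun σ hσ => by
      have h := hI.convex hz hzδ (sub_nonneg.2 hσ.2) hσ.1 (sub_add_cancel 1 σ)
      have h2 : (1 - σ) • z.im + σ • (z.im + δ) = z.im + σ * δ := by
        simp only [smul_eq_mul]
        ring
      rwa [h2] at h
    refine ⟨fun σ : ℝ => G (z + σ * (d / w)), ?_, by simpa using hGz, ?_⟩
    · refine hG.comp (φ := fun σ : ℝ => (z + σ * (d / w) : ℂ)) (by fun_prop) (fun σ hσ => ?_)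
        fun σ _ σ' _ => ?_
      · have := hconv σ hσ
        rw [hδ] at this
        change (z + σ * (d / w) : ℂ).im ∈ I
        rwa [Complex.add_im, Complex.im_ofReal_mul]
      · simp only [ContinuousLinearMap.toSpanSingleton_apply, Complex.real_smul,
          ContinuousLinearMap.mul_apply']
        push_cast
        field_simp
        ring
    · rw [flowsTo_iff]
      refine ⟨fun s : ℝ => G (z + s * (u / w)), by simpa using hGz, ?_, ?_⟩
      · have h1 : (z + (1 : ℝ) * (d / w) : ℂ) ∈ strip I := by
          have := hconv 1 ⟨zero_le_one, le_rfl⟩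
          rw [one_mul] at this
          rw [Complex.ofReal_one, one_mul]
          exact this
        change G (z + T * (u / w)) = _ +ᵥ G (z + (1 : ℝ) * (d / w))
        rw [← hG1 _ h1, hdw]
        congr 1
        push_cast
        ring
      · refine hG.comp (φ := fun s : ℝ => (z + s * (u / w) : ℂ)) (by fun_prop) (fun s hs => ?_)
          fun s _ s' _ => ?_
        · rw [← segment_eq_uIcc] at hs
          obtain ⟨a, σ, ha, hσ, haσ, rfl⟩ := hs
          have := hconv σ ⟨hσ, by linarith⟩
          change (z + (a • (0 : ℝ) + σ • T : ℝ) * (u / w) : ℂ).im ∈ I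
          convert! this using 1
          have h2 : ((a • (0 : ℝ) + σ • T : ℝ) * (u / w) : ℂ) = σ * (d / w + 1) := by
            rw [hdw]
            simp
            ring
          rw [h2, Complex.add_im, Complex.im_ofReal_mul]
          simp [hδ]
        · simp only [ContinuousLinearMap.toSpanSingleton_apply, Complex.real_smul,
            ContinuousLinearMap.mul_apply']
          push_cast
          field_simp
          ring

end IsZ2Cover

end Strips

/-! ### Ergodicity of the cover -/

section Ergodicity

/-- Invariant sets stay invariant when the zeros are removed: no trajectory meets them. -/
theorem AbelianDifferential.diff_zeros_invariant {X : Type*} [TopologicalSpace X]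
    [ChartedSpace ℂ X] {η : AbelianDifferential X} {θ : ℝ} {B : Set X}
    (hB : ∀ t x y, η.FlowsTo θ t x y → (x ∈ B ↔ y ∈ B)) (t : ℝ) (x y : X)
    (h : η.FlowsTo θ t x y) : x ∈ B \ η.zeros ↔ y ∈ B \ η.zeros := by
  have h1 := hB t x y h
  obtain ⟨c, rfl, rfl, hc, -⟩ := h
  have h2 := hc 0 left_mem_uIcc
  have h3 := hc t right_mem_uIcc
  simp [h1, h2, h3]

variable {M : Type*} [TopologicalSpace M] [ChartedSpace ℂ M] [IsManifold 𝓘(ℂ, ℂ) ω M]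
  [MeasurableSpace M] [BorelSpace M]
  {N : Type*} [TopologicalSpace N] [ChartedSpace ℂ N] [IsManifold 𝓘(ℂ, ℂ) ω N]
  [MeasurableSpace N] [BorelSpace N]
  [AddAction (ℤ × ℤ) N] {η : AbelianDifferential M} {ηN : AbelianDifferential N}
  {γ₁ γ₂ : H1 M} {p : N → M} {θ : ℝ}

namespace IsZ2Cover

open AbelianDifferential

omit [MeasurableSpace M] [BorelSpace M] [MeasurableSpace N] [BorelSpace N] in
/-- Since trajectories lift, the image of an invariant set is invariant. -/
theorem image_invariant (hp : IsZ2Cover η γ₁ γ₂ ηN p) {B : Set N}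
    (hB : ∀ t x y, ηN.FlowsTo θ t x y → (x ∈ B ↔ y ∈ B)) (t : ℝ) (x y : M)
    (h : η.FlowsTo θ t x y) : x ∈ p '' B ↔ y ∈ p '' B := by
  have key : ∀ t x y, η.FlowsTo θ t x y → x ∈ p '' B → y ∈ p '' B := by
    rintro t _ y h ⟨x, hx, rfl⟩
    obtain ⟨y', rfl, hy'⟩ := hp.exists_flowsTo h
    exact ⟨y', (hB t x y' hy').1 hx, rfl⟩
  exact ⟨key t x y h, key (-t) y x h.symm⟩

/-- The image in the base of an invariant set of the cover has zero or full area. -/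
theorem image_null_or_conull [SecondCountableTopology M] (hp : IsZ2Cover η γ₁ γ₂ ηN p)
    (hθ : η.IsErgodicDirection θ) {B : Set N} (hBm : MeasurableSet B)
    (hB : ∀ t x y, ηN.FlowsTo θ t x y → (x ∈ B ↔ y ∈ B)) :
    η.area (p '' (B \ ηN.zeros)) = 0 ∨ η.area (p '' (B \ ηN.zeros))ᶜ = 0 := by
  have := hp.secondCountableTopology
  exact hθ _ (hp.measurableSet_image (hBm.diff ηN.isClosed_zeros.measurableSet) fun x hx => hx.2)
    (hp.image_invariant (diff_zeros_invariant hB))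

variable [T2Space M] [CompactSpace M]

omit [IsManifold 𝓘(ℂ, ℂ) ω N] [MeasurableSpace N] [BorelSpace N] [TopologicalSpace N]
  [ChartedSpace ℂ N] [AddAction (ℤ × ℤ) N] in
/-- Strips that approximate `θ` well include strips with an arbitrarily small drift. -/
theorem _root_.TranslationSurface.WellApproximatedByStrips.exists_small_drift {p : N → M}
    [TopologicalSpace N] {k : ℤ × ℤ} (h : WellApproximatedByStrips η γ₁ γ₂ p θ k) :
    ∃ ε > 0, ∀ ρ > 0, ∃ (C : Set M) (w : ℂ) (g : ClosedGeodesic η w), IsCylinder η w C ∧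
      range g.toFun ⊆ C ∧
      (intersection γ₁ g.homologyClass, intersection γ₂ g.homologyClass) = k ∧
      ENNReal.ofReal ε < η.area C ∧
      |Real.cos θ * w.im - Real.sin θ * w.re| < ρ ∧
      ‖w‖ * |Real.cos θ * w.im - Real.sin θ * w.re| ≤ (η.area C).toReal / 2 := by
  have : SecondCountableTopology M := ChartedSpace.secondCountable_of_sigmaCompact ℂ M
  have : IsFiniteMeasure η.area := ⟨η.area_lt_top⟩
  obtain ⟨-, ε, hε, hinf⟩ := h
  refine ⟨ε, hε, fun ρ hρ => ?_⟩
  set a := (η.area univ).toReal with ha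
  have ha0 : 0 ≤ a := ENNReal.toReal_nonneg
  set L := a / ρ with hL
  obtain ⟨C, ⟨S, -, w, g, hC, hg, hk, hCε, hdrift⟩, hCL⟩ :=
    (hinf.sdiff (η.finite_short_cylinders hε L)).nonempty
  have hwL : L < ‖w‖ := by
    by_contra! hle
    exact hCL ⟨w, hC, hCε, hle⟩
  have hw0 : 0 < ‖w‖ := norm_pos_iff.2 g.displacement_ne_zero
  have hCa : (η.area C).toReal ≤ a := ENNReal.toReal_mono (measure_ne_top _ _)
    (measure_mono (subset_univ C))
  have hC0 : 0 ≤ (η.area C).toReal := ENNReal.toReal_nonneg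
  set b := |Real.cos θ * w.im - Real.sin θ * w.re| with hb
  have hbA : ‖w‖ * b ≤ (η.area C).toReal / 2 := by
    have h1 : (1 - ε) * ((η.area C).toReal / (2 * ‖w‖)) ≤ (η.area C).toReal / (2 * ‖w‖) :=
      mul_le_of_le_one_left (by positivity) (by linarith)
    calc ‖w‖ * b ≤ ‖w‖ * ((η.area C).toReal / (2 * ‖w‖)) := by
          gcongr
          exact hdrift.trans h1
      _ = (η.area C).toReal / 2 := by field_simp
  refine ⟨C, w, g, hC, hg, hk, hCε, ?_, hbA⟩
  have h2 : a < ‖w‖ * ρ := by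
    rw [hL, div_lt_iff₀ hρ] at hwL
    exact hwL
  by_contra! hle
  have h3 : ‖w‖ * ρ ≤ ‖w‖ * b := by gcongr
  linarith

/-- If `θ` is well approximated by strips producing `k`, then invariant sets of the cover are
invariant under the deck transformation `k`, up to null sets. The exceptional set projects to an
invariant set of the base; if that had full area, large parts of the strips would lie over it, but
there the return maps approximate `k`. -/
theorem area_image_eq_zero (hp : IsZ2Cover η γ₁ γ₂ ηN p) (hθ : η.IsErgodicDirection θ)
    {k : ℤ × ℤ} (hk : WellApproximatedByStrips η γ₁ γ₂ p θ k) {A : Set N} (hA : MeasurableSet A)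
    (hinv : ∀ t x y, ηN.FlowsTo θ t x y → (x ∈ A ↔ y ∈ A)) :
    η.area (p '' ({x | ¬(x ∈ A ↔ k +ᵥ x ∈ A)} \ ηN.zeros)) = 0 := by
  have : SecondCountableTopology M := ChartedSpace.secondCountable_of_sigmaCompact ℂ M
  have : SecondCountableTopology N := hp.secondCountableTopology
  have : T2Space N := hp.t2Space
  have : IsFiniteMeasure η.area := ⟨η.area_lt_top⟩
  set B := {x | ¬(x ∈ A ↔ k +ᵥ x ∈ A)} with hB
  have hAk : MeasurableSet ((fun x => k +ᵥ x) ⁻¹' A) := (hp.continuous_deck k).measurable hA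
  have hBm : MeasurableSet B := by
    have : B = symmDiff A ((fun x => k +ᵥ x) ⁻¹' A) := by
      ext x
      simp only [hB, mem_ofPred_eq, mem_symmDiff, mem_preimage]
      tauto
    rw [this]
    exact hA.symmDiff hAk
  have hBinv : ∀ t x y, ηN.FlowsTo θ t x y → (x ∈ B ↔ y ∈ B) := fun t x y h => by
    simp only [hB, mem_ofPred_eq, hinv t x y h, hinv t _ _ (hp.vadd_flowsTo h k)]
  refine (hp.image_null_or_conull hθ hBm hBinv).resolve_right fun hconull => ?_
  set D := B \ ηN.zeros with hD
  have hDm : MeasurableSet D := hBm.diff ηN.isClosed_zeros.measurableSet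
  obtain ⟨Q, c, r, hQ, hcov⟩ := hp.exists_disc_cover
  set V : ℕ → Set N := fun i => (Q i).source ∩ Q i ⁻¹' Metric.ball (c i) (r i) with hV
  have hVo : ∀ i, IsOpen (V i) := fun i => (Q i).isOpen_inter_preimage Metric.isOpen_ball
  have hDV : ∀ i, MeasurableSet (p '' (D ∩ V i)) := fun i =>
    ((hQ i).2.2.2 _ (inter_subset_right.trans inter_subset_left)
      (hDm.inter (hVo i).measurableSet)).1
  obtain ⟨ε, hε, hstrip⟩ := hk.exists_small_drift
  -- Finitely many discs carry the exceptional set up to area `ε / 4`.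
  obtain ⟨n, hn⟩ : ∃ n, η.area (⋃ i < n, p '' (D ∩ V i))ᶜ < ENNReal.ofReal (ε / 4) := by
    have hanti : Antitone fun n => (⋃ i < n, p '' (D ∩ V i))ᶜ := fun n m hnm =>
      compl_subset_compl.2 (biUnion_subset_biUnion_left fun i hi => lt_of_lt_of_le hi hnm)
    have hlim := tendsto_measure_iInter_atTop (μ := η.area)
      (fun n => (MeasurableSet.iUnion fun i => MeasurableSet.iUnion fun _ : i < n =>
        hDV i).compl.nullMeasurableSet) hanti ⟨0, measure_ne_top _ _⟩
    have h0 : η.area (⋂ n, (⋃ i < n, p '' (D ∩ V i))ᶜ) = 0 := by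
      refine measure_mono_null (fun x hx => ?_) hconull
      rintro ⟨y, hy, rfl⟩
      obtain ⟨i, hi⟩ := mem_iUnion.1 (hcov hy.2)
      exact mem_iInter.1 hx (i + 1) (mem_biUnion (lt_add_one i) ⟨y, ⟨hy, hi⟩, rfl⟩)
    rw [h0] at hlim
    exact (hlim.eventually_lt_const (ENNReal.ofReal_pos.2 (by positivity))).exists
  -- On each of them the part over a strip of small drift has small area.
  set ε' := ENNReal.ofReal (ε / (4 * (n + 1))) with hε'
  have hε'0 : 0 < ε' := ENNReal.ofReal_pos.2 (by positivity)
  have hev : ∀ᶠ d in 𝓝 (0 : ℂ), ∀ i < n, ‖d‖ < r i ∧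
      ∀ B ⊆ V i, MeasurableSet B → (∀ x ∈ B, ¬(x ∈ A ↔ k +ᵥ x ∈ A)) →
        (∀ x ∈ B, x ∈ A ↔ k +ᵥ (Q i).symm (Q i x + d) ∈ A) → ηN.area B ≤ ε' := by
    refine (eventually_all_finite (finite_lt_nat n)).2 fun i _ => ?_
    refine Filter.Eventually.and ?_
      (hp.eventually_area_le (hQ i).1 (hQ i).2.1 (hQ i).2.2.1 hA k hε'0)
    filter_upwards [Metric.ball_mem_nhds (0 : ℂ) (hQ i).2.1] with d hd
    simpa using hd
  obtain ⟨ρ, hρ, hball⟩ := Metric.eventually_nhds_iff_ball.1 hev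
  obtain ⟨C, w, g, hC, hg, hgk, hCε, hdrift, hdrift'⟩ := hstrip ρ hρ
  obtain ⟨U, hUo, hUarea, T, d, hd, hret⟩ := hp.exists_return hC g hg θ
  rw [hgk] at hret
  have hdρ : d ∈ Metric.ball (0 : ℂ) ρ := by
    rw [mem_ball_zero_iff, hd]
    exact hdrift
  have hpart : ∀ i < n, η.area (p '' (D ∩ V i) ∩ U) ≤ ε' := fun i hi => by
    obtain ⟨hdr, hsmall⟩ := hball d hdρ i hi
    have hm : MeasurableSet (D ∩ V i ∩ p ⁻¹' U) :=
      (hDm.inter (hVo i).measurableSet).inter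
        (hUo.preimage hp.isCoveringMap.continuous).measurableSet
    rw [← image_inter_preimage, ((hQ i).2.2.2 _ (fun x hx => hx.1.2.1) hm).2]
    refine hsmall _ (fun x hx => hx.1.2) hm (fun x hx => hx.1.1.1) fun x hx => ?_
    obtain ⟨c', hc', hc0, hflow⟩ := hret x hx.2
    rw [hinv T _ _ hflow]
    -- In the disc the displacement by `d` is a translation.
    have hxV : dist (Q i x) (c i) < r i := hx.1.2.2
    have hseg : ηN.IsDeveloped (line d) (fun σ : ℝ => (Q i).symm (Q i x + line d σ))
        (Icc 0 1) := by
      refine ((hQ i).1.isDeveloped_symm _ _).mono fun σ hσ => (hQ i).2.2.1 ?_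
      rw [mem_ball_iff_norm, add_sub_right_comm, ContinuousLinearMap.toSpanSingleton_apply]
      rw [dist_eq_norm] at hxV
      have h1 : ‖σ • d‖ ≤ ‖d‖ := by
        rw [norm_smul, Real.norm_eq_abs, abs_of_nonneg hσ.1]
        exact mul_le_of_le_one_left (norm_nonneg _) hσ.2
      linarith [norm_add_le (Q i x - c i) (σ • d)]
    have := hc'.eqOn hseg isPreconnected_Icc (left_mem_Icc.2 zero_le_one)
      (by simp [hc0, (Q i).left_inv hx.1.2.1]) (right_mem_Icc.2 zero_le_one)
    rw [this]
    simp
  have hU1 : η.area U ≤ ENNReal.ofReal (ε / 4) + n * ε' := by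
    have hsub : U ⊆ (⋃ i < n, p '' (D ∩ V i))ᶜ ∪ ⋃ i ∈ Finset.range n, p '' (D ∩ V i) ∩ U := by
      intro x hx
      by_cases h : x ∈ ⋃ i < n, p '' (D ∩ V i)
      · simp only [mem_iUnion] at h
        obtain ⟨i, hi, hxi⟩ := h
        exact Or.inr (mem_biUnion (Finset.mem_coe.2 (Finset.mem_range.2 hi)) ⟨hxi, hx⟩)
      · exact Or.inl h
    refine (measure_mono hsub).trans ((measure_union_le _ _).trans (add_le_add hn.le ?_))
    refine (measure_biUnion_finset_le _ _).trans ?_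
    refine (Finset.sum_le_card_nsmul _ _ ε' fun i hi => hpart i (Finset.mem_range.1 hi)).trans ?_
    simp
  have hU2 : ENNReal.ofReal (ε / 4) + n * ε' < ENNReal.ofReal (ε / 2) := by
    have h1 : (n : ENNReal) * ε' = ENNReal.ofReal (n * (ε / (4 * (n + 1)))) := by
      rw [ENNReal.ofReal_mul (by positivity), ENNReal.ofReal_natCast]
    rw [h1, ← ENNReal.ofReal_add (by positivity) (by positivity)]
    refine (ENNReal.ofReal_lt_ofReal_iff (by positivity)).2 ?_
    have h2 : n * (ε / (4 * (n + 1))) < ε / 4 := by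
      have h3 : n * (ε / (4 * (n + 1))) = ε / 4 * (n / (n + 1)) := by field_simp
      rw [h3]
      refine mul_lt_of_lt_one_right (by positivity) ?_
      rw [div_lt_one (by positivity)]
      linarith
    linarith
  -- The part of the cylinder that returns has at least half of its area.
  have hU3 : ENNReal.ofReal (ε / 2) ≤ η.area U := by
    have hCt : η.area C ≠ ⊤ := measure_ne_top _ _
    have hUt : η.area U ≠ ⊤ := measure_ne_top _ _
    have h1 := hUarea.trans (add_le_add_right (ENNReal.ofReal_le_ofReal hdrift') _)
    have h2 : (η.area C).toReal ≤ (η.area U).toReal + (η.area C).toReal / 2 := by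
      have := ENNReal.toReal_mono (by finiteness) h1
      rwa [ENNReal.toReal_add hUt ENNReal.ofReal_ne_top,
        ENNReal.toReal_ofReal (by positivity)] at this
    have h3 : ε < (η.area C).toReal := (ENNReal.ofReal_lt_iff_lt_toReal hε.le hCt).1 hCε
    rw [ENNReal.ofReal_le_iff_le_toReal hUt]
    linarith
  exact (hU3.trans_lt (hU1.trans_lt hU2)).false

/-- Almost every fibre lies on one side of an invariant set, since the set is invariant under
generators of the deck group. If the set and its complement had positive area, ergodicity of the
base would let almost every fibre meet both. -/
theorem isErgodicDirection (hp : IsZ2Cover η γ₁ γ₂ ηN p) (hθ : η.IsErgodicDirection θ)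
    {kh kv : ℤ × ℤ} (hkh : kh = (1, 0) ∨ kh = (-1, 0)) (hkv : kv = (0, 1) ∨ kv = (0, -1))
    (hh : WellApproximatedByStrips η γ₁ γ₂ p θ kh) (hv : WellApproximatedByStrips η γ₁ γ₂ p θ kv) :
    ηN.IsErgodicDirection θ := fun A hA hinv => by
  have : SecondCountableTopology M := ChartedSpace.secondCountable_of_sigmaCompact ℂ M
  have hinvc : ∀ t x y, ηN.FlowsTo θ t x y → (x ∈ Aᶜ ↔ y ∈ Aᶜ) := fun t x y h =>
    not_congr (hinv t x y h)
  rcases hp.image_null_or_conull hθ hA hinv with h1 | h1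
  · exact Or.inl (hp.area_eq_zero_of_image hA h1)
  rcases hp.image_null_or_conull hθ hA.compl hinvc with h2 | h2
  · exact Or.inr (hp.area_eq_zero_of_image hA.compl h2)
  -- Otherwise almost every fibre meets both `A` and its complement, while almost every fibre is
  -- contained in one of them.
  have h3 := hp.area_image_eq_zero hθ hh hA hinv
  have h4 := hp.area_image_eq_zero hθ hv hA hinv
  refine Or.inl (hp.area_eq_zero_of_image hA (measure_mono_null ?_
    (measure_union_null h2 (measure_union_null h3 h4))))
  rintro _ ⟨x, ⟨hxA, hxz⟩, rfl⟩
  by_contra hx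
  simp only [mem_union, not_or, mem_compl_iff, not_not] at hx
  obtain ⟨⟨y, ⟨hyA, -⟩, hyx⟩, hx3, hx4⟩ := hx
  have hgen : ∀ k : ℤ × ℤ, p x ∉ p '' ({x | ¬(x ∈ A ↔ k +ᵥ x ∈ A)} \ ηN.zeros) →
      ∀ y, p y = p x → (y ∈ A ↔ k +ᵥ y ∈ A) := fun k hk y hy => by
    by_contra h
    refine hk ⟨y, ⟨h, fun hyz => hxz ?_⟩, hy⟩
    rw [hp.mem_zeros_iff, ← hy]
    exact (hp.mem_zeros_iff y).1 hyz
  -- The deck transformations that preserve the side of `A` on the fibre of `x` form a subgroup.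
  let H : AddSubgroup (ℤ × ℤ) :=
    { carrier := {k : ℤ × ℤ | ∀ y, p y = p x → (y ∈ A ↔ k +ᵥ y ∈ A)}
      zero_mem' := fun y _ => by rw [zero_vadd]
      add_mem' := fun {a b} ha hb y hy => by
        rw [add_vadd]
        exact (hb y hy).trans (ha _ ((hp.deck b y).trans hy))
      neg_mem' := fun {a} ha y hy => by
        have := ha (-a +ᵥ y) ((hp.deck _ y).trans hy)
        rw [vadd_neg_vadd] at this
        exact this.symm }
  have hH1 : ((1, 0) : ℤ × ℤ) ∈ H := by
    rcases hkh with rfl | rfl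
    · exact hgen _ hx3
    · simpa using H.neg_mem (hgen _ hx3 : ((-1, 0) : ℤ × ℤ) ∈ H)
  have hH2 : ((0, 1) : ℤ × ℤ) ∈ H := by
    rcases hkv with rfl | rfl
    · exact hgen _ hx4
    · simpa using H.neg_mem (hgen _ hx4 : ((0, -1) : ℤ × ℤ) ∈ H)
  obtain ⟨n, hn, -⟩ := hp.fibre x y hyx.symm
  have hnH : n ∈ H := by
    have := H.add_mem (H.zsmul_mem hH1 n.1) (H.zsmul_mem hH2 n.2)
    simpa using this
  have := hnH x rfl
  rw [hn] at this
  exact hyA (this.1 hxA)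

end IsZ2Cover

end Ergodicity

end TranslationSurface

theorem mainTheorem5
    {M : Type*} [TopologicalSpace M] [ChartedSpace ℂ M] [IsManifold 𝓘(ℂ, ℂ) ω M]
    [CompactSpace M] [T2Space M] [ConnectedSpace M] [MeasurableSpace M] [BorelSpace M]
    (η : TranslationSurface.AbelianDifferential M)
    (γ₁ γ₂ : TranslationSurface.H1 M) (hγ : LinearIndependent ℤ ![γ₁, γ₂])
    (hγ₁ : η.hol γ₁ = 0) (hγ₂ : η.hol γ₂ = 0)
    {N : Type*} [TopologicalSpace N] [ChartedSpace ℂ N] [IsManifold 𝓘(ℂ, ℂ) ω N]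
    [MeasurableSpace N] [BorelSpace N] [AddAction (ℤ × ℤ) N]
    (ηN : TranslationSurface.AbelianDifferential N) (p : N → M)
    (hp : TranslationSurface.IsZ2Cover η γ₁ γ₂ ηN p)
    (θ : ℝ) (hθ : η.IsErgodicDirection θ)
    (kh kv : ℤ × ℤ) (hkh : kh = (1, 0) ∨ kh = (-1, 0)) (hkv : kv = (0, 1) ∨ kv = (0, -1))
    (hh : TranslationSurface.WellApproximatedByStrips η γ₁ γ₂ p θ kh)
    (hv : TranslationSurface.WellApproximatedByStrips η γ₁ γ₂ p θ kv) :
    ηN.IsErgodicDirection θ :=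
  hp.isErgodicDirection hθ hkh hkv hh hv
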